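/- **Theorem 4.1 (Profile Decomposition).** For $f\in L^2(\mathbb R^3)$ (complex valued) let $\hat f(\xi)=\int e^{-ix\cdot\xi}f(x)\,dx$ (extended by Plancherel), $\|f\|_{H^1}=\|(1+|\xi|)\hat f\|_{L^2_\xi}$, $\|f\|_{\dot H^s}=\||\xi|^s\hat f\|_{L^2_\xi}$, and let $e^{it\Delta}$ be the Fourier multiplier with symbol $e^{-it|\xi|^2}$. Fix numbers $4^+>4$ and $6^-<6$ ($4^+=\infty$ is allowed) and let $$\|u\|_{S(\dot H^{1/2})}=\sup\Big\{\|u\|_{L^q_tL^r_x}:\ \tfrac2q+\tfrac3r=1,\ 3\le r\le 6^-,\ 4^+\le q\le\infty\Big\}.$$ Let $\{\phi_n\}$ and $\{\widetilde\phi_n\}$ be two bounded sequences in $H^1(\mathbb R^3)$. Then there are a subsequence of the indices $n$, the same for both sequences (the corresponding subsequences are still denoted by $\{\phi_n\}$ and $\{\widetilde\phi_n\}$), and * profiles $\psi^j,\widetilde\psi^j\in H^1(\mathbb R^3)$ for $j\ge1$, * time shifts $t_n^j\in\mathbb R$ and space shifts $x_n^j\in\mathbb R^3$ for $j\ge1$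 and all $n$, common to both sequences, * remainders $W_n^M,\widetilde W_n^M\in H^1(\mathbb R^3)$ for all $M\ge 0$ and all $n$, such that for all $M\ge0$ and all $n$ $$(\phi_n,\widetilde\phi_n)=\sum_{j=1}^M\big(e^{-it_n^j\Delta}\psi^j(\cdot-x_n^j),\,e^{-it_n^j\Delta}\widetilde\psi^j(\cdot-x_n^j)\big)+(W_n^M,\widetilde W_n^M),$$ and the following hold. 1. For all $j\ne k$, $\displaystyle\lim_{n\to\infty}\big(|t_n^j-t_n^k|+|x_n^j-x_n^k|\big)=\infty$. 2. For every $M$ the limit $\displaystyle L_M=\lim_{n\to\infty}\big(\|e^{it\Delta}W_n^M\|_{S(\dot H^{1/2})}+\|e^{it\Delta}\widetilde W_n^M\|_{S(\dot H^{1/2})}\big)$ exists and is finite, and $\displaystyle\lim_{M\to\infty}L_M=0$. 3. For every $s\in[0,1]$ and every $M$, as $n\to\infty$, $$\|\phi_n\|_{\dot H^s}^2=\sum_{j=1}^M\|\psi^j\|_{\dot H^s}^2+\|W_n^M\|_{\dot H^s}^2+o_n(1),\qquad \|\widetilde\phi_n\|_{\dot H^s}^2=\sum_{j=1}^M\|\widetilde\psi^j\|_{\dot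 H^s}^2+\|\widetilde W_n^M\|_{\dot H^s}^2+o_n(1).$$ -/

import Mathlib

open MeasureTheory Filter Topology FourierTransform
open scoped ENNReal NNReal

namespace ProfileDecomposition

/-- The physical space `ℝ³` with the Euclidean norm and Lebesgue measure. -/
abbrev R3 : Type := EuclideanSpace ℝ (Fin 3)

/-- Complex valued square integrable functions on `ℝ³` (modulo a.e. equality). -/
abbrev L2 : Type := Lp ℂ 2 (volume : Measure R3)

/-- The spatial Fourier transform `f̂(ξ) = ∫ e^{-i x·ξ} f(x) dx` of an `L²` function (extended from
integrable functions by Plancherel). Mathlib's `𝓕` has the kernel `e^{-2πi x·ξ}`, hence the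
dilation. -/
noncomputable def hat (f : L2) : R3 → ℂ := fun ξ => (𝓕 f : L2) ((2 * Real.pi)⁻¹ • ξ)

/-- The norm `‖f‖_{H^s} = ‖(1+|ξ|)^s f̂‖_{L²}`, possibly infinite. -/
noncomputable def sobolevNorm (s : ℝ) (f : L2) : ℝ≥0∞ :=
  eLpNorm (fun ξ : R3 => (((1 + ‖ξ‖) ^ s : ℝ) : ℂ) * hat f ξ) 2 volume

/-- The norm `‖f‖_{Ḣ^s} = ‖|ξ|^s f̂‖_{L²}`, possibly infinite. -/
noncomputable def homSobolevNorm (s : ℝ) (f : L2) : ℝ≥0∞ :=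
  eLpNorm (fun ξ : R3 => ((‖ξ‖ ^ s : ℝ) : ℂ) * hat f ξ) 2 volume

/-- Membership in `H¹(ℝ³)`. -/
def MemH1 (f : L2) : Prop := sobolevNorm 1 f < ∞

/-- The sequence `f` is bounded in `H¹(ℝ³)`. -/
def BoundedInH1 (f : ℕ → L2) : Prop := ∃ C : ℝ≥0, ∀ n, sobolevNorm 1 (f n) ≤ C

/-- The symbol `e^{-it|2πξ|²}` of `e^{itΔ}` in the frequency variable of Mathlib's `𝓕`. -/
noncomputable def schrodingerSymbol (t : ℝ) (ξ : R3) : ℂ :=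
  Complex.exp (((-(t * ‖(2 * Real.pi) • ξ‖ ^ 2) : ℝ) : ℂ) * Complex.I)

theorem memLp_schrodingerSymbol_mul (t : ℝ) (g : L2) :
    MemLp (fun ξ : R3 => schrodingerSymbol t ξ * g ξ) 2 volume := by
  refine (Lp.memLp g).of_le (f := fun ξ : R3 => schrodingerSymbol t ξ * g ξ) ?_ ?_
  · refine AEStronglyMeasurable.mul ?_ (Lp.memLp g).1
    refine Continuous.aestronglyMeasurable ?_
    unfold schrodingerSymbol
    fun_prop
  · refine Eventually.of_forall fun ξ => ?_
    rw [norm_mul, schrodingerSymbol, Complex.norm_exp_ofReal_mul_I, one_mul]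

/-- The free Schrödinger group `e^{itΔ}` on `L²(ℝ³)`, as a Fourier multiplier. -/
noncomputable def schrodinger (t : ℝ) (f : L2) : L2 :=
  𝓕⁻ ((memLp_schrodingerSymbol_mul t (𝓕 f)).toLp : L2)

/-- The translate `x ↦ f(x - y)`. -/
noncomputable def spaceShift (y : R3) (f : L2) : L2 :=
  Lp.compMeasurePreserving (fun x : R3 => x - y) (measurePreserving_sub_right volume y) f

/-- The mixed norm `‖u‖_{L^q_t L^r_x}` of `u(x,t)`, time being the first argument. -/
noncomputable def mixedNorm (q r : ℝ≥0∞) (u : ℝ → L2) : ℝ≥0∞ :=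
  eLpNorm (fun t : ℝ => eLpNorm (u t) r (volume : Measure R3)) q volume

/-- `(q, r)` is `Ḣ^{1/2}` admissible: `2/q + 3/r = 3/2 - 1/2` (with `c/∞ = 0`). -/
def HalfAdmissible (q r : ℝ≥0∞) : Prop := 2 / q + 3 / r = 1

/-- The norm `‖u‖_{S(Ḣ^{1/2})}`, the supremum of `‖u‖_{L^q_t L^r_x}` over the `Ḣ^{1/2}` admissible
pairs with `3 ≤ r ≤ 6⁻` and `4⁺ ≤ q ≤ ∞`. The preselected numbers `4⁺ > 4` and `6⁻ < 6` are the
arguments `q₀` and `r₀`. -/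
noncomputable def strichartzNorm (q₀ r₀ : ℝ≥0∞) (u : ℝ → L2) : ℝ≥0∞ :=
  ⨆ (q : ℝ≥0∞) (r : ℝ≥0∞) (_ : HalfAdmissible q r ∧ 3 ≤ r ∧ r ≤ r₀ ∧ q₀ ≤ q), mixedNorm q r u

end ProfileDecomposition

namespace ProfileDecomposition

section WeakLimits

variable {ι H : Type*} [NormedAddCommGroup H] [InnerProductSpace ℂ H]

/-- Weak convergence in a Hilbert space along a filter. -/
def WeakTendsto (f : ι → H) (l : Filter ι) (x : H) : Prop :=
  ∀ v : H, Tendsto (fun n => inner ℂ v (f n)) l (𝓝 (inner ℂ v x))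

theorem WeakTendsto.sub {f g : ι → H} {l : Filter ι} {x y : H} (hf : WeakTendsto f l x)
    (hg : WeakTendsto g l y) : WeakTendsto (fun n => f n - g n) l (x - y) := fun v => by
  simpa only [inner_sub_right] using (hf v).sub (hg v)

theorem WeakTendsto.unique {f : ι → H} {l : Filter ι} [l.NeBot] {x y : H}
    (hx : WeakTendsto f l x) (hy : WeakTendsto f l y) : x = y :=
  ext_inner_left ℂ fun v => tendsto_nhds_unique (hx v) (hy v)

theorem WeakTendsto.norm_le {f : ι → H} {l : Filter ι} [l.NeBot] {x : H} {C : ℝ}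
    (hx : WeakTendsto f l x) (hf : ∀ n, ‖f n‖ ≤ C) : ‖x‖ ≤ C := by
  have h1 : Tendsto (fun n => ‖inner ℂ x (f n)‖) l (𝓝 ‖inner ℂ x x‖) := (hx x).norm
  have h2 : ‖inner ℂ x x‖ ≤ ‖x‖ * C := le_of_tendsto h1 <| Eventually.of_forall fun n =>
    (norm_inner_le_norm _ _).trans (mul_le_mul_of_nonneg_left (hf n) (norm_nonneg _))
  rw [inner_self_eq_norm_sq_to_K] at h2
  simp only [Complex.coe_algebraMap, norm_pow, Complex.norm_real, norm_norm] at h2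
  rcases eq_or_lt_of_le (norm_nonneg x) with h | h
  · obtain ⟨n⟩ : Nonempty ι := l.nonempty_of_neBot
    rw [← h]; exact (norm_nonneg _).trans (hf n)
  · nlinarith

theorem exists_tendsto_ultrafilter_of_norm_le (𝒰 : Ultrafilter ι) {f : ι → ℂ} {C : ℝ}
    (hf : ∀ n, ‖f n‖ ≤ C) : ∃ z, Tendsto f 𝒰 (𝓝 z) := by
  obtain ⟨z, -, hz⟩ := (isCompact_closedBall (0 : ℂ) C).ultrafilter_le_nhds (𝒰.map f) (by
    simp only [le_principal_iff, Ultrafilter.mem_coe, Ultrafilter.mem_map]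
    filter_upwards with n
    simpa using hf n)
  exact ⟨z, hz⟩

theorem exists_weakTendsto [CompleteSpace H] (𝒰 : Ultrafilter ι) {f : ι → H} {C : ℝ}
    (hf : ∀ n, ‖f n‖ ≤ C) : ∃ x, WeakTendsto f 𝒰 x := by
  have h1 : ∀ v : H, ∃ z, Tendsto (fun n => inner ℂ (f n) v) 𝒰 (𝓝 z) := fun v =>
    exists_tendsto_ultrafilter_of_norm_le 𝒰 (C := C * ‖v‖) fun n =>
      (norm_inner_le_norm _ _).trans (mul_le_mul_of_nonneg_right (hf n) (norm_nonneg _))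
  choose L hL using h1
  let Λ : H →ₗ[ℂ] ℂ :=
    { toFun := L
      map_add' := fun v w => tendsto_nhds_unique (hL (v + w)) (by
        simpa only [inner_add_right] using (hL v).add (hL w))
      map_smul' := fun c v => tendsto_nhds_unique (hL (c • v)) (by
        simpa only [inner_smul_right, smul_eq_mul, RingHom.id_apply] using (hL v).const_mul c) }
  let Λ' : StrongDual ℂ H := Λ.mkContinuous C fun v =>
    le_of_tendsto (hL v).norm <| Eventually.of_forall fun n =>
      (norm_inner_le_norm _ _).trans (mul_le_mul_of_nonneg_right (hf n) (norm_nonneg _))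
  refine ⟨(InnerProductSpace.toDual ℂ H).symm Λ', fun v => ?_⟩
  have h2 : inner ℂ ((InnerProductSpace.toDual ℂ H).symm Λ') v = L v := by
    rw [InnerProductSpace.toDual_symm_apply]; rfl
  have h3 := (Complex.continuous_conj.tendsto _).comp (hL v)
  rw [← h2] at h3
  simpa only [Function.comp_def, inner_conj_symm] using h3

/-- A bounded sequence converges weakly to zero once it does so against a dense set. -/
theorem weakTendsto_zero_of_dense {f : ι → H} {l : Filter ι} {C : ℝ} (hf : ∀ n, ‖f n‖ ≤ C)
    {D : Set H} (hD : Dense D) (h : ∀ v ∈ D, Tendsto (fun n => inner ℂ v (f n)) l (𝓝 0)) :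
    WeakTendsto f l 0 := by
  intro v
  rw [inner_zero_right, Metric.tendsto_nhds]
  intro ε hε
  have hC : 0 < |C| + 1 := by positivity
  obtain ⟨w, hwD, hw⟩ := hD.exists_dist_lt v (ε := ε / (2 * (|C| + 1))) (by positivity)
  filter_upwards [Metric.tendsto_nhds.1 (h w hwD) (ε / 2) (by positivity)] with n hn
  rw [dist_zero_right] at hn ⊢
  have h1 : inner ℂ v (f n) = inner ℂ (v - w) (f n) + inner ℂ w (f n) := by
    rw [inner_sub_left]; ring
  have h2 : ‖inner ℂ (v - w) (f n)‖ ≤ ε / 2 := by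
    refine (norm_inner_le_norm _ _).trans ?_
    rw [dist_eq_norm] at hw
    calc ‖v - w‖ * ‖f n‖ ≤ ε / (2 * (|C| + 1)) * (|C| + 1) := by
          gcongr
          exact ((hf n).trans (le_abs_self C)).trans (by linarith)
      _ = ε / 2 := by field_simp
  rw [h1]
  linarith [norm_add_le (inner ℂ (v - w) (f n)) (inner ℂ w (f n))]

end WeakLimits

section Representation

variable {ι H G : Type*} [NormedAddCommGroup H] [InnerProductSpace ℂ H]
  [NormedAddCommGroup G]

/-- A strongly continuous unitary representation whose matrix coefficients vanish at infinity. -/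
structure IsMixingRep (U : G → H ≃ₗᵢ[ℂ] H) : Prop where
  map_add : ∀ a b v, U (a + b) v = U a (U b v)
  continuous : ∀ v, Continuous fun g => U g v
  decay : ∀ u v, Tendsto (fun g => inner ℂ u (U g v)) (cocompact G) (𝓝 0)

variable {U : G → H ≃ₗᵢ[ℂ] H}

theorem IsMixingRep.map_zero (hU : IsMixingRep U) (v : H) : U 0 v = v := by
  have h := hU.map_add 0 0 v
  rw [add_zero] at h
  exact ((U 0).injective h).symm

theorem IsMixingRep.neg_apply (hU : IsMixingRep U) (g : G) (v : H) : U (-g) (U g v) = v := by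
  rw [← hU.map_add, neg_add_cancel, hU.map_zero]

theorem IsMixingRep.apply_neg (hU : IsMixingRep U) (g : G) (v : H) : U g (U (-g) v) = v := by
  rw [← hU.map_add, add_neg_cancel, hU.map_zero]

theorem IsMixingRep.inner_apply (hU : IsMixingRep U) (g : G) (u v : H) :
    inner ℂ u (U g v) = inner ℂ (U (-g) u) v := by
  conv_lhs => rw [← hU.apply_neg g u]
  exact (U g).inner_map_map _ _

theorem IsMixingRep.weakTendsto_cocompact (hU : IsMixingRep U) {g : ι → G} {l : Filter ι}
    (hg : Tendsto g l (cocompact G)) (v : H) : WeakTendsto (fun n => U (g n) v) l 0 := fun u => by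
  rw [inner_zero_right]; exact (hU.decay u v).comp hg

theorem IsMixingRep.weakTendsto_apply (hU : IsMixingRep U) {g : ι → G} {l : Filter ι} {a : G}
    (hg : Tendsto g l (𝓝 a)) {f : ι → H} {C : ℝ} (hf : ∀ n, ‖f n‖ ≤ C)
    (h0 : WeakTendsto f l 0) : WeakTendsto (fun n => U (g n) (f n)) l 0 := by
  intro v
  have h1 : Tendsto (fun n => U (-g n) v - U (-a) v) l (𝓝 0) := by
    have := (((hU.continuous v).tendsto (-a)).comp hg.neg).sub_const (U (-a) v)
    simpa using this
  have h2 : Tendsto (fun n => inner ℂ (U (-g n) v - U (-a) v) (f n)) l (𝓝 0) := by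
    have h3 := h1.norm.mul_const C
    rw [norm_zero, zero_mul] at h3
    refine squeeze_zero_norm (fun n => ?_) h3
    exact (norm_inner_le_norm _ _).trans (mul_le_mul_of_nonneg_left (hf n) (norm_nonneg _))
  have h4 := h2.add (h0 (U (-a) v))
  rw [inner_zero_right, add_zero] at h4
  rw [inner_zero_right]
  refine h4.congr fun n => ?_
  rw [hU.inner_apply, inner_sub_left]
  ring

/-- Asymptotic Pythagoras identity for an operator commuting with the representation. -/
theorem IsMixingRep.tendsto_norm_sq_sub (hU : IsMixingRep U) [CompleteSpace H] {H' : Type*}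
    [NormedAddCommGroup H'] [InnerProductSpace ℂ H'] [CompleteSpace H'] {U' : G → H' ≃ₗᵢ[ℂ] H'}
    (T : H →L[ℂ] H') (hT : ∀ g v, T (U g v) = U' g (T v)) {l : Filter ι} {g : ι → G} {w r : ι → H}
    {ψ : H} (hw : ∀ n, w n = U (g n) ψ + r n) (hr : WeakTendsto (fun n => U (-g n) (r n)) l 0) :
    Tendsto (fun n => ‖T (w n)‖ ^ 2 - ‖T ψ‖ ^ 2 - ‖T (r n)‖ ^ 2) l (𝓝 0) := by
  have h1 := (Complex.continuous_re.tendsto _).comp (hr (T.adjoint (T ψ)))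
  rw [inner_zero_right, Complex.zero_re] at h1
  have h2 := h1.const_mul 2
  rw [mul_zero] at h2
  refine h2.congr fun n => ?_
  have h3 : T (w n) = U' (g n) (T ψ + T (U (-g n) (r n))) := by
    rw [hw n, _root_.map_add, hT, _root_.map_add, ← hT _ (U (-g n) (r n)), hU.apply_neg]
  have h4 : T (r n) = U' (g n) (T (U (-g n) (r n))) := by
    rw [← hT, hU.apply_neg]
  rw [h3, h4, LinearIsometryEquiv.norm_map, LinearIsometryEquiv.norm_map,
    @norm_add_sq ℂ, Function.comp_apply, ContinuousLinearMap.adjoint_inner_left]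
  simp only [RCLike.re_to_complex]
  ring

theorem exists_tendsto_of_not_tendsto_cocompact {𝒰 : Ultrafilter ι} {g : ι → G}
    (h : ¬ Tendsto g 𝒰 (cocompact G)) : ∃ a, Tendsto g 𝒰 (𝓝 a) := by
  rw [(hasBasis_cocompact (X := G)).tendsto_right_iff] at h
  push Not at h
  obtain ⟨K, hK, hKn⟩ := h
  have h1 : {n | g n ∈ K} ∈ 𝒰 := by
    filter_upwards [hKn] with n hn
    simpa using hn
  obtain ⟨a, -, ha⟩ := hK.ultrafilter_le_nhds (𝒰.map g) (by
    rw [le_principal_iff, Ultrafilter.mem_coe, Ultrafilter.mem_map]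
    exact h1)
  exact ⟨a, ha⟩

end Representation

section Extraction

variable {H G : Type*} [NormedAddCommGroup H] [InnerProductSpace ℂ H] [NormedAddCommGroup G]
  {U : G → H ≃ₗᵢ[ℂ] H} {𝒰 : Ultrafilter ℕ}

theorem exists_tendsto_sub_cocompact [NormedSpace ℝ G] [ProperSpace G] [Nontrivial G] (h𝒰 : (𝒰 : Filter ℕ) ≤ atTop)
    (s : List (ℕ → G)) :
    ∃ g : ℕ → G, ∀ h ∈ s, Tendsto (fun n => g n - h n) 𝒰 (cocompact G) := by
  have h1 : ∀ n : ℕ, ∃ a : G, (n : ℝ) + (s.map fun h => ‖h n‖).sum < ‖a‖ := fun n =>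
    NormedSpace.exists_lt_norm ℝ G _
  choose g hg using h1
  refine ⟨g, fun h hh => ?_⟩
  rw [← Metric.cobounded_eq_cocompact, ← tendsto_norm_atTop_iff_cobounded]
  refine tendsto_atTop_mono (fun n => ?_) (tendsto_natCast_atTop_atTop.mono_left h𝒰)
  have h2 : ‖h n‖ ≤ (s.map fun h => ‖h n‖).sum := by
    refine List.single_le_sum ?_ _ (List.mem_map.2 ⟨h, hh, rfl⟩)
    intro x hx
    obtain ⟨k, -, rfl⟩ := List.mem_map.1 hx
    exact norm_nonneg _
  have h3 := norm_sub_norm_le (g n) (h n)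
  have h4 := hg n
  linarith

/-- The remainder `W` is bounded and has lost all profiles along the sequences in `s`. -/
def IsReduced (U : G → H ≃ₗᵢ[ℂ] H) (𝒰 : Ultrafilter ℕ) (S : List (ℕ → G) × (ℕ → H)) : Prop :=
  (∃ C : ℝ, ∀ n, ‖S.2 n‖ ≤ C) ∧ ∀ h ∈ S.1, WeakTendsto (fun n => U (-h n) (S.2 n)) 𝒰 0

theorem IsMixingRep.exists_profile [CompleteSpace H] [NormedSpace ℝ G] [ProperSpace G] [Nontrivial G] (hU : IsMixingRep U)
    (h𝒰 : (𝒰 : Filter ℕ) ≤ atTop) {S : List (ℕ → G) × (ℕ → H)} (hS : IsReduced U 𝒰 S) :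
    ∃ (g : ℕ → G) (ψ : H), (∀ h ∈ S.1, Tendsto (fun n => g n - h n) 𝒰 (cocompact G)) ∧
      WeakTendsto (fun n => U (-g n) (S.2 n)) 𝒰 ψ ∧
      ∀ (h : ℕ → G) (χ : H), WeakTendsto (fun n => U (-h n) (S.2 n)) 𝒰 χ → ‖χ‖ ≤ 2 * ‖ψ‖ := by
  obtain ⟨⟨C, hC⟩, hS0⟩ := hS
  have hC' : ∀ (h : ℕ → G) n, ‖U (-h n) (S.2 n)‖ ≤ C := fun h n => by
    rw [LinearIsometryEquiv.norm_map]; exact hC n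
  let A : Set ℝ := {a | ∃ (g : ℕ → G) (ψ : H),
    (∀ h ∈ S.1, Tendsto (fun n => g n - h n) 𝒰 (cocompact G)) ∧
      WeakTendsto (fun n => U (-g n) (S.2 n)) 𝒰 ψ ∧ a = ‖ψ‖}
  have hA : BddAbove A := by
    refine ⟨C, ?_⟩
    rintro _ ⟨g, ψ, -, h2, rfl⟩
    exact h2.norm_le (hC' g)
  have hne : A.Nonempty := by
    obtain ⟨g, hg⟩ := exists_tendsto_sub_cocompact h𝒰 S.1
    obtain ⟨ψ, hψ⟩ := exists_weakTendsto 𝒰 (hC' g)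
    exact ⟨_, g, ψ, hg, hψ, rfl⟩
  have hmem : ∀ (h : ℕ → G) (χ : H), WeakTendsto (fun n => U (-h n) (S.2 n)) 𝒰 χ → χ ≠ 0 →
      ‖χ‖ ∈ A := by
    intro h χ hχ hχ0
    refine ⟨h, χ, fun k hk => ?_, hχ, rfl⟩
    by_contra hnt
    obtain ⟨a, ha⟩ := exists_tendsto_of_not_tendsto_cocompact hnt
    refine hχ0 (hχ.unique ?_)
    have h1 := hU.weakTendsto_apply ha.neg (hC' k) (hS0 k hk)
    intro v
    refine (h1 v).congr fun n => ?_
    dsimp only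
    rw [← hU.map_add]
    congr 3
    abel
  rcases (le_or_gt (sSup A) 0) with h0 | h0
  · obtain ⟨a, g, ψ, hg, hψ, rfl⟩ := hne
    refine ⟨g, ψ, hg, hψ, fun h χ hχ => ?_⟩
    by_cases hχ0 : χ = 0
    · rw [hχ0, norm_zero]; positivity
    · exact ((le_csSup hA (hmem h χ hχ hχ0)).trans h0).trans (by positivity)
  · obtain ⟨_, ⟨g, ψ, hg, hψ, rfl⟩, hlt⟩ := exists_lt_of_lt_csSup hne (half_lt_self h0)
    refine ⟨g, ψ, hg, hψ, fun h χ hχ => ?_⟩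
    by_cases hχ0 : χ = 0
    · rw [hχ0, norm_zero]; positivity
    · linarith [le_csSup hA (hmem h χ hχ hχ0)]

theorem IsMixingRep.isReduced_step (hU : IsMixingRep U) {S : List (ℕ → G) × (ℕ → H)}
    (hS : IsReduced U 𝒰 S) {g : ℕ → G} {ψ : H}
    (hg : ∀ h ∈ S.1, Tendsto (fun n => g n - h n) 𝒰 (cocompact G))
    (hψ : WeakTendsto (fun n => U (-g n) (S.2 n)) 𝒰 ψ) :
    IsReduced U 𝒰 (g :: S.1, fun n => S.2 n - U (g n) ψ) := by
  obtain ⟨⟨C, hC⟩, hS0⟩ := hS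
  refine ⟨⟨C + ‖ψ‖, fun n => (norm_sub_le _ _).trans ?_⟩, fun h hh => ?_⟩
  · rw [LinearIsometryEquiv.norm_map]; gcongr; exact hC n
  · rcases List.mem_cons.1 hh with rfl | hh
    · have h1 : WeakTendsto (fun _ : ℕ => ψ) 𝒰 ψ := fun v => tendsto_const_nhds
      have h2 := hψ.sub h1
      rw [sub_self] at h2
      intro v
      refine (h2 v).congr fun n => ?_
      simp only [map_sub, hU.neg_apply]
    · have h2 := (hS0 h hh).sub (hU.weakTendsto_cocompact (hg h hh) ψ)
      rw [sub_self] at h2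
      intro v
      refine (h2 v).congr fun n => ?_
      simp only [map_sub, ← hU.map_add]
      congr 4
      abel

/-- Profile decomposition of a bounded sequence along an ultrafilter, for a mixing unitary
representation. -/
theorem IsMixingRep.exists_profileDecomposition [CompleteSpace H] [NormedSpace ℝ G] [ProperSpace G]
    [Nontrivial G] (hU : IsMixingRep U)
    (h𝒰 : (𝒰 : Filter ℕ) ≤ atTop) {φ : ℕ → H} {C : ℝ} (hφ : ∀ n, ‖φ n‖ ≤ C) :
    ∃ (ψ : ℕ → H) (g : ℕ → ℕ → G) (W : ℕ → ℕ → H),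
      (∀ n, W 0 n = φ n) ∧ (∀ M n, W M n = U (g M n) (ψ M) + W (M + 1) n) ∧
      (∀ j k, j ≠ k → Tendsto (fun n => g j n - g k n) 𝒰 (cocompact G)) ∧
      (∀ M, WeakTendsto (fun n => U (-g M n) (W (M + 1) n)) 𝒰 0) ∧
      Tendsto ψ atTop (𝓝 0) ∧
      (∀ M, ∀ᶠ n in 𝒰, ‖W M n‖ ≤ C + 1) ∧
      (∀ M, ∃ D, ∀ n, ‖W M n‖ ≤ D) ∧
      (∀ M (h : ℕ → G) (χ : H), WeakTendsto (fun n => U (-h n) (W M n)) 𝒰 χ →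
        ‖χ‖ ≤ 2 * ‖ψ M‖) := by
  have hstep : ∀ S : {S // IsReduced U 𝒰 S}, ∃ (g : ℕ → G) (ψ : H),
      (∀ h ∈ S.1.1, Tendsto (fun n => g n - h n) 𝒰 (cocompact G)) ∧
      WeakTendsto (fun n => U (-g n) (S.1.2 n)) 𝒰 ψ ∧
      ∀ (h : ℕ → G) (χ : H), WeakTendsto (fun n => U (-h n) (S.1.2 n)) 𝒰 χ → ‖χ‖ ≤ 2 * ‖ψ‖ :=
    fun S => hU.exists_profile h𝒰 S.2
  choose γ Ψ h1 h2 h3 using hstep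
  let S : ℕ → {S // IsReduced U 𝒰 S} := fun M => Nat.rec
    ⟨([], φ), ⟨C, hφ⟩, by simp⟩
    (fun _ S => ⟨(γ S :: S.1.1, fun n => S.1.2 n - U (γ S n) (Ψ S)),
      hU.isReduced_step S.2 (h1 S) (h2 S)⟩) M
  have hS : ∀ M, (S (M + 1)).1 =
      (γ (S M) :: (S M).1.1, fun n => (S M).1.2 n - U (γ (S M) n) (Ψ (S M))) := fun M => rfl
  have hW : ∀ M n, (S M).1.2 n = U (γ (S M) n) (Ψ (S M)) + (S (M + 1)).1.2 n := fun M n => by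
    rw [hS]; simp
  have hmem : ∀ j k, j < k → γ (S j) ∈ (S k).1.1 := by
    intro j k hjk
    induction k, hjk using Nat.le_induction with
    | base => rw [hS]; exact List.mem_cons_self
    | succ k _ ih => rw [hS]; exact List.mem_cons_of_mem _ ih
  have hweak : ∀ M, WeakTendsto (fun n => U (-γ (S M) n) ((S (M + 1)).1.2 n)) 𝒰 0 := fun M =>
    (S (M + 1)).2.2 _ (hmem M (M + 1) (Nat.lt_succ_self M))
  have hpyth : ∀ M, Tendsto (fun n => ‖φ n‖ ^ 2 - ∑ j ∈ Finset.range M, ‖Ψ (S j)‖ ^ 2 -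
      ‖(S M).1.2 n‖ ^ 2) 𝒰 (𝓝 0) := by
    intro M
    induction M with
    | zero =>
      refine tendsto_const_nhds.congr fun n => ?_
      simp [S]
    | succ M ih =>
      have := ih.add (hU.tendsto_norm_sq_sub (U' := U) (ContinuousLinearMap.id ℂ H)
        (fun _ _ => rfl) (hW M) (hweak M))
      rw [add_zero] at this
      refine this.congr fun n => ?_
      simp only [ContinuousLinearMap.id_apply, Finset.sum_range_succ]
      ring
  have hC0 : 0 ≤ C := (norm_nonneg _).trans (hφ 0)
  have hsum : ∀ M, ∑ j ∈ Finset.range M, ‖Ψ (S j)‖ ^ 2 ≤ C ^ 2 := by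
    intro M
    have h4 : ∀ n, ‖φ n‖ ^ 2 - ∑ j ∈ Finset.range M, ‖Ψ (S j)‖ ^ 2 - ‖(S M).1.2 n‖ ^ 2 ≤
        C ^ 2 - ∑ j ∈ Finset.range M, ‖Ψ (S j)‖ ^ 2 := fun n => by
      have := pow_le_pow_left₀ (norm_nonneg _) (hφ n) 2
      nlinarith [sq_nonneg ‖(S M).1.2 n‖]
    have := le_of_tendsto (hpyth M) (Eventually.of_forall h4)
    linarith
  refine ⟨fun M => Ψ (S M), fun M => γ (S M), fun M => (S M).1.2, fun n => rfl, hW, ?_, hweak,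
    ?_, ?_, fun M => (S M).2.1, fun M => h3 (S M)⟩
  · intro j k hjk
    rcases lt_or_gt_of_ne hjk with h | h
    · have h5 := (Homeomorph.neg G).isClosedEmbedding.tendsto_cocompact.comp
        (h1 (S k) _ (hmem j k h))
      refine h5.congr fun n => ?_
      simp
    · exact h1 (S j) _ (hmem k j h)
  · have h6 : Summable fun j => ‖Ψ (S j)‖ ^ 2 :=
      summable_of_sum_range_le (fun _ => sq_nonneg _) hsum
    rw [tendsto_zero_iff_norm_tendsto_zero]
    have h7 := h6.tendsto_atTop_zero.sqrt
    simpa only [Real.sqrt_zero, Real.sqrt_sq (norm_nonneg _)] using h7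
  · intro M
    have h8 := (hpyth M).eventually (lt_mem_nhds (show (-1 : ℝ) < 0 by norm_num))
    filter_upwards [h8] with n hn
    have h9 := pow_le_pow_left₀ (norm_nonneg _) (hφ n) 2
    have h10 : 0 ≤ ∑ j ∈ Finset.range M, ‖Ψ (S j)‖ ^ 2 :=
      Finset.sum_nonneg fun _ _ => sq_nonneg _
    refine abs_le_of_sq_le_sq' ?_ (by linarith) |>.2
    nlinarith

end Extraction

theorem exists_strictMono_tendsto (𝓛 : Filter ℕ) [𝓛.NeBot] [𝓛.IsCountablyGenerated]
    (h : 𝓛 ≤ atTop) : ∃ σ : ℕ → ℕ, StrictMono σ ∧ Tendsto σ atTop 𝓛 := by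
  obtain ⟨x, hx⟩ := exists_seq_tendsto 𝓛
  obtain ⟨θ, hθ, hm⟩ := strictMono_subseq_of_tendsto_atTop (hx.mono_right h)
  exact ⟨x ∘ θ, hm, hx.comp hθ.tendsto_atTop⟩

/-- The group of time and space translations. -/
abbrev ShiftGroup : Type := ℝ × R3

/-- The phase of the translation by `g` in time and space, on the Fourier side. -/
noncomputable def phase (g : ShiftGroup) (ξ : R3) : ℝ :=
  -(g.1 * ‖(2 * Real.pi) • ξ‖ ^ 2) - 2 * Real.pi * inner ℝ g.2 ξ

/-- The Fourier symbol of the translation by `g` in time and space. -/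
noncomputable def shiftSymbol (g : ShiftGroup) (ξ : R3) : ℂ := Complex.exp (phase g ξ * Complex.I)

theorem continuous_phase : Continuous fun p : ShiftGroup × R3 => phase p.1 p.2 := by
  unfold phase; fun_prop

theorem continuous_shiftSymbol : Continuous fun p : ShiftGroup × R3 => shiftSymbol p.1 p.2 := by
  have := continuous_phase
  unfold shiftSymbol; fun_prop

theorem continuous_shiftSymbol_right (g : ShiftGroup) : Continuous (shiftSymbol g) :=
  continuous_shiftSymbol.comp (by fun_prop : Continuous fun ξ : R3 => (g, ξ))

theorem continuous_shiftSymbol_left (ξ : R3) : Continuous fun g => shiftSymbol g ξ :=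
  continuous_shiftSymbol.comp (by fun_prop : Continuous fun g : ShiftGroup => (g, ξ))

theorem norm_shiftSymbol (g : ShiftGroup) (ξ : R3) : ‖shiftSymbol g ξ‖ = 1 :=
  Complex.norm_exp_ofReal_mul_I _

theorem shiftSymbol_add (a b : ShiftGroup) (ξ : R3) :
    shiftSymbol (a + b) ξ = shiftSymbol a ξ * shiftSymbol b ξ := by
  rw [shiftSymbol, shiftSymbol, shiftSymbol, ← Complex.exp_add]
  congr 1
  simp only [phase, Prod.fst_add, Prod.snd_add, inner_add_left]
  push_cast
  ring

theorem shiftSymbol_zero (ξ : R3) : shiftSymbol 0 ξ = 1 := by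
  simp [shiftSymbol, phase]

theorem shiftSymbol_neg_mul (g : ShiftGroup) (ξ : R3) :
    shiftSymbol (-g) ξ * shiftSymbol g ξ = 1 := by
  rw [← shiftSymbol_add, neg_add_cancel, shiftSymbol_zero]

theorem conj_shiftSymbol (g : ShiftGroup) (ξ : R3) :
    (starRingEnd ℂ) (shiftSymbol g ξ) = shiftSymbol (-g) ξ := by
  rw [shiftSymbol, shiftSymbol, ← Complex.exp_conj]
  congr 1
  simp only [phase, map_mul, Complex.conj_ofReal, Complex.conj_I, Prod.fst_neg, Prod.snd_neg,
    inner_neg_left]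
  push_cast
  ring

theorem integrable_shiftSymbol_mul {F : R3 → ℂ} (hF : Integrable F) (g : ShiftGroup) :
    Integrable fun ξ => shiftSymbol g ξ * F ξ :=
  hF.bdd_mul (continuous_shiftSymbol_right g).aestronglyMeasurable
    (Eventually.of_forall fun ξ => (norm_shiftSymbol g ξ).le)

theorem continuous_integral_shiftSymbol_mul {F : R3 → ℂ} (hF : Integrable F) :
    Continuous fun g => ∫ ξ, shiftSymbol g ξ * F ξ := by
  refine continuous_of_dominated (bound := fun ξ => ‖F ξ‖) ?_ ?_ hF.norm ?_
  · exact fun g => (integrable_shiftSymbol_mul hF g).aestronglyMeasurable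
  · exact fun g => Eventually.of_forall fun ξ => by rw [norm_mul, norm_shiftSymbol, one_mul]
  · exact Eventually.of_forall fun ξ => (continuous_shiftSymbol_left ξ).mul continuous_const

theorem norm_integral_shiftSymbol_mul_le (F : R3 → ℂ) (g : ShiftGroup) :
    ‖∫ ξ, shiftSymbol g ξ * F ξ‖ ≤ ∫ ξ, ‖F ξ‖ := by
  refine (norm_integral_le_integral_norm _).trans_eq ?_
  simp only [norm_mul, norm_shiftSymbol, one_mul]

theorem norm_gaussian_factor_le {b : ℂ} (hb : 0 < b.re) (r : ℝ) :
    ‖(Real.pi / b : ℂ) ^ (Module.finrank ℝ R3 / 2 : ℂ) *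
      Complex.exp (-Real.pi ^ 2 * r ^ 2 / b)‖ ≤ (Real.pi / ‖b‖) ^ (3 / 2 : ℝ) := by
  have h1 : (Module.finrank ℝ R3 / 2 : ℂ) = ((3 / 2 : ℝ) : ℂ) := by simp
  rw [norm_mul, h1, Complex.norm_cpow_real, norm_div, Complex.norm_real,
    Real.norm_of_nonneg Real.pi_pos.le, Complex.norm_exp]
  refine mul_le_of_le_one_right (by positivity) (Real.exp_le_one_iff.2 ?_)
  have h2 : (-Real.pi ^ 2 * r ^ 2 / b : ℂ) = ((-(Real.pi ^ 2 * r ^ 2) : ℝ) : ℂ) * b⁻¹ := by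
    push_cast; ring
  rw [h2, Complex.re_ofReal_mul, Complex.inv_re]
  have h3 : 0 ≤ b.re / Complex.normSq b := div_nonneg hb.le (Complex.normSq_nonneg b)
  nlinarith [mul_nonneg (sq_nonneg (Real.pi * r)) h3]

/-- The damped symbol as a Gaussian. -/
theorem exp_mul_shiftSymbol (ε : ℝ) (g : ShiftGroup) (ξ : R3) :
    (Real.exp (-(ε * ‖(2 * Real.pi) • ξ‖ ^ 2)) : ℂ) * shiftSymbol g ξ =
      Complex.exp (-((4 * Real.pi ^ 2 : ℝ) * (ε + g.1 * Complex.I)) * ‖ξ‖ ^ 2 +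
        2 * Real.pi * Complex.I * (inner ℝ (-g.2) ξ : ℝ)) := by
  rw [shiftSymbol, Complex.ofReal_exp, ← Complex.exp_add]
  congr 1
  simp only [phase, norm_smul, inner_neg_left, mul_pow, Real.norm_eq_abs, sq_abs]
  push_cast
  ring

theorem re_gaussian_parameter {ε : ℝ} (hε : 0 < ε) (t : ℝ) :
    0 < (((4 * Real.pi ^ 2 : ℝ) : ℂ) * (ε + t * Complex.I)).re := by
  rw [Complex.re_ofReal_mul]
  have : (ε + t * Complex.I : ℂ).re = ε := by simp
  rw [this]
  positivity

theorem norm_gaussian_parameter (ε t : ℝ) :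
    ‖((4 * Real.pi ^ 2 : ℝ) : ℂ) * (ε + t * Complex.I)‖ =
      4 * Real.pi ^ 2 * √(ε ^ 2 + t ^ 2) := by
  rw [norm_mul, Complex.norm_real, Real.norm_of_nonneg (by positivity), Complex.norm_add_mul_I]

theorem integrable_exp_mul_shiftSymbol {ε : ℝ} (hε : 0 < ε) (g : ShiftGroup) :
    Integrable fun ξ => (Real.exp (-(ε * ‖(2 * Real.pi) • ξ‖ ^ 2)) : ℂ) * shiftSymbol g ξ := by
  simp only [exp_mul_shiftSymbol]
  exact GaussianFourier.integrable_cexp_neg_mul_sq_norm_add (re_gaussian_parameter hε g.1) _ _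

/-- The dispersive estimate for the damped Schrödinger kernel and its Fourier transform. -/
theorem norm_fourier_exp_mul_shiftSymbol_le {ε : ℝ} (hε : 0 < ε) (g : ShiftGroup) (w : R3) :
    ‖𝓕 (fun ξ : R3 => (Real.exp (-(ε * ‖(2 * Real.pi) • ξ‖ ^ 2)) : ℂ) * shiftSymbol g ξ) w‖ ≤
      (4 * Real.pi * √(ε ^ 2 + g.1 ^ 2)) ^ (-(3 / 2) : ℝ) := by
  simp only [exp_mul_shiftSymbol]
  rw [fourier_gaussian_innerProductSpace' (re_gaussian_parameter hε g.1)]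
  refine (norm_gaussian_factor_le (re_gaussian_parameter hε g.1) _).trans_eq ?_
  rw [norm_gaussian_parameter, Real.rpow_neg (by positivity), ← Real.inv_rpow (by positivity)]
  congr 1
  field_simp

theorem norm_integral_exp_mul_shiftSymbol_le {ε : ℝ} (hε : 0 < ε) (g : ShiftGroup) :
    ‖∫ ξ : R3, (Real.exp (-(ε * ‖(2 * Real.pi) • ξ‖ ^ 2)) : ℂ) * shiftSymbol g ξ‖ ≤
      (4 * Real.pi * √(ε ^ 2 + g.1 ^ 2)) ^ (-(3 / 2) : ℝ) := by
  have h := norm_fourier_exp_mul_shiftSymbol_le hε g 0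
  rw [Real.fourier_eq'] at h
  simpa only [inner_zero_right, mul_zero, Complex.ofReal_zero, zero_mul, Complex.exp_zero,
    one_smul] using h

theorem norm_integral_shiftSymbol_mul_schwartz_le (f : SchwartzMap R3 ℂ) (g : ShiftGroup)
    (hg : g.1 ≠ 0) :
    ‖∫ ξ, shiftSymbol g ξ * f ξ‖ ≤
      (4 * Real.pi * |g.1|) ^ (-(3 / 2) : ℝ) * ∫ x, ‖(𝓕⁻ f) x‖ := by
  set h : SchwartzMap R3 ℂ := 𝓕⁻ f with hh
  have hf : 𝓕 h = f := FourierTransform.fourier_fourierInv_eq f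
  let k : ℝ → R3 → ℂ := fun ε ξ =>
    (Real.exp (-(ε * ‖(2 * Real.pi) • ξ‖ ^ 2)) : ℂ) * shiftSymbol g ξ
  have h1 : ∀ ε > 0, ‖∫ ξ, k ε ξ * f ξ‖ ≤
      (4 * Real.pi * |g.1|) ^ (-(3 / 2) : ℝ) * ∫ x, ‖h x‖ := by
    intro ε hε
    have h2 : ∫ ξ, 𝓕 (k ε) ξ • h ξ = ∫ ξ, k ε ξ • 𝓕 (h : R3 → ℂ) ξ := by
      have := VectorFourier.integral_fourierIntegral_smul_eq_flip (L := innerₗ R3)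
        Real.continuous_fourierChar continuous_inner
        (integrable_exp_mul_shiftSymbol hε g) h.integrable (μ := volume) (ν := volume)
      rw [flip_innerₗ] at this
      exact this
    have h3 : ∫ ξ, k ε ξ * f ξ = ∫ ξ, 𝓕 (k ε) ξ • h ξ := by
      rw [h2, ← hf]; rfl
    rw [h3, ← integral_const_mul]
    refine norm_integral_le_of_norm_le (h.integrable.norm.const_mul _)
      (Eventually.of_forall fun ξ => ?_)
    rw [norm_smul]
    gcongr
    refine (norm_fourier_exp_mul_shiftSymbol_le hε g ξ).trans ?_
    have h0 : 0 < |g.1| := abs_pos.2 hg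
    refine Real.rpow_le_rpow_of_nonpos (by positivity) ?_ (by norm_num)
    gcongr
    rw [← Real.sqrt_sq_eq_abs]
    exact Real.sqrt_le_sqrt (by nlinarith [sq_nonneg ε])
  have h4 : Tendsto (fun ε : ℝ => ∫ ξ, k ε ξ * f ξ) (𝓝[>] 0)
      (𝓝 (∫ ξ, shiftSymbol g ξ * f ξ)) := by
    refine tendsto_integral_filter_of_dominated_convergence (fun ξ => ‖f ξ‖) ?_ ?_
      f.integrable.norm ?_
    · filter_upwards [self_mem_nhdsWithin] with ε hε
      exact (integrable_exp_mul_shiftSymbol hε g).aestronglyMeasurable.mul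
        f.integrable.aestronglyMeasurable
    · filter_upwards [self_mem_nhdsWithin] with ε hε
      refine Eventually.of_forall fun ξ => ?_
      rw [norm_mul, norm_mul, norm_shiftSymbol, mul_one, Complex.norm_real,
        Real.norm_of_nonneg (Real.exp_pos _).le]
      refine mul_le_of_le_one_left (norm_nonneg _) (Real.exp_le_one_iff.2 ?_)
      have : (0 : ℝ) < ε := hε
      rw [neg_nonpos]; positivity
    · refine Eventually.of_forall fun ξ => ?_
      have hc : Continuous fun ε : ℝ => k ε ξ * f ξ := by fun_prop
      have := (hc.tendsto 0).mono_left (nhdsWithin_le_nhds (s := Set.Ioi 0))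
      simpa [k] using this
  refine le_of_tendsto h4.norm ?_
  filter_upwards [self_mem_nhdsWithin] with ε hε using h1 ε hε

theorem tendsto_integral_shiftSymbol_mul_of_time {F : R3 → ℂ} (hF : Integrable F) {ι : Type*}
    {l : Filter ι} {g : ι → ShiftGroup} (hg : Tendsto (fun n => |(g n).1|) l atTop) :
    Tendsto (fun n => ∫ ξ, shiftSymbol (g n) ξ * F ξ) l (𝓝 0) := by
  rw [Metric.tendsto_nhds]
  intro ε hε
  obtain ⟨f, hf⟩ := (Metric.denseRange_iff.1
    (SchwartzMap.denseRange_toLpCLM (E := R3) (F := ℂ) (μ := volume) (p := 1) ENNReal.one_ne_top))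
    (hF.toL1 F) (ε / 2) (by positivity)
  have h1 : ∫ ξ, ‖F ξ - f ξ‖ < ε / 2 := by
    rw [dist_eq_norm, L1.norm_eq_integral_norm] at hf
    refine (integral_congr_ae ?_).trans_lt hf
    have h2 : SchwartzMap.toLpCLM ℝ ℂ 1 volume f =ᵐ[volume] f := SchwartzMap.coeFn_toLp f 1 volume
    filter_upwards [Lp.coeFn_sub (hF.toL1 F) (SchwartzMap.toLpCLM ℝ ℂ 1 volume f), h2,
      hF.coeFn_toL1] with ξ h3 h4 h5
    rw [h3, Pi.sub_apply, h4, h5]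
  have h6 : Tendsto (fun n => (4 * Real.pi * |(g n).1|) ^ (-(3 / 2) : ℝ) * ∫ x, ‖(𝓕⁻ f) x‖) l
      (𝓝 0) := by
    have := ((tendsto_rpow_neg_atTop (show (0 : ℝ) < 3 / 2 by norm_num)).comp
      (hg.const_mul_atTop (show 0 < 4 * Real.pi by positivity))).mul_const (∫ x, ‖(𝓕⁻ f) x‖)
    rwa [zero_mul] at this
  filter_upwards [h6.eventually (gt_mem_nhds (half_pos hε)), hg.eventually_gt_atTop 0] with n h7 h8
  rw [dist_zero_right]
  have h9 : ∫ ξ, shiftSymbol (g n) ξ * F ξ = (∫ ξ, shiftSymbol (g n) ξ * (F ξ - f ξ)) +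
      ∫ ξ, shiftSymbol (g n) ξ * f ξ := by
    rw [← integral_add]
    · congr 1; ext ξ; ring
    · exact integrable_shiftSymbol_mul (hF.sub f.integrable) _
    · exact integrable_shiftSymbol_mul f.integrable _
  rw [h9]
  have h10 := norm_integral_shiftSymbol_mul_schwartz_le f (g n) (abs_pos.1 h8)
  have h11 := norm_integral_shiftSymbol_mul_le (fun ξ => F ξ - f ξ) (g n)
  linarith [norm_add_le (∫ ξ, shiftSymbol (g n) ξ * (F ξ - f ξ)) (∫ ξ, shiftSymbol (g n) ξ * f ξ)]

theorem tendsto_integral_shiftSymbol_mul_of_space {F : R3 → ℂ} (hF : Integrable F) {ι : Type*}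
    {l : Filter ι} {g : ι → ShiftGroup} {a : ℝ} (ha : Tendsto (fun n => (g n).1) l (𝓝 a))
    (hg : Tendsto (fun n => (g n).2) l (cocompact R3)) :
    Tendsto (fun n => ∫ ξ, shiftSymbol (g n) ξ * F ξ) l (𝓝 0) := by
  have hF' := integrable_shiftSymbol_mul hF (a, 0)
  have h1 : Tendsto (fun n => ∫ ξ, shiftSymbol (0, (g n).2) ξ * (shiftSymbol (a, 0) ξ * F ξ)) l
      (𝓝 0) := by
    have := (tendsto_integral_exp_inner_smul_cocompact fun ξ => shiftSymbol (a, 0) ξ * F ξ).comp hg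
    refine this.congr fun n => ?_
    refine integral_congr_ae (Eventually.of_forall fun ξ => ?_)
    simp only [Circle.smul_def, Real.fourierChar_apply, smul_eq_mul]
    congr 1
    simp only [shiftSymbol, phase]
    congr 1
    rw [real_inner_comm]
    push_cast
    ring
  have h2 : Tendsto (fun s : ℝ => ∫ ξ, ‖shiftSymbol (s, 0) ξ - shiftSymbol (a, 0) ξ‖ * ‖F ξ‖) (𝓝 a)
      (𝓝 0) := by
    have hc : Continuous fun s : ℝ =>
        ∫ ξ, ‖shiftSymbol (s, 0) ξ - shiftSymbol (a, 0) ξ‖ * ‖F ξ‖ := by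
      refine continuous_of_dominated (bound := fun ξ => 2 * ‖F ξ‖) ?_ ?_ (hF.norm.const_mul 2) ?_
      · exact fun s => (((continuous_shiftSymbol_right _).sub
          (continuous_shiftSymbol_right _)).norm.aestronglyMeasurable).mul
          hF.norm.aestronglyMeasurable
      · refine fun s => Eventually.of_forall fun ξ => ?_
        rw [norm_mul, norm_norm, norm_norm]
        gcongr
        refine (norm_sub_le _ _).trans ?_
        rw [norm_shiftSymbol, norm_shiftSymbol]; norm_num
      · refine Eventually.of_forall fun ξ => ?_
        have := (continuous_shiftSymbol_left ξ).comp
          (by fun_prop : Continuous fun s : ℝ => ((s, 0) : ShiftGroup))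
        exact ((this.sub continuous_const).norm).mul continuous_const
    have := hc.tendsto a
    simpa using this
  have h3 : Tendsto (fun n => ∫ ξ, (shiftSymbol (g n) ξ -
      shiftSymbol (0, (g n).2) ξ * shiftSymbol (a, 0) ξ) * F ξ) l (𝓝 0) := by
    refine squeeze_zero_norm (fun n => ?_) (h2.comp ha)
    refine (norm_integral_le_integral_norm _).trans_eq ?_
    refine integral_congr_ae (Eventually.of_forall fun ξ => ?_)
    have : shiftSymbol (g n) ξ = shiftSymbol (0, (g n).2) ξ * shiftSymbol ((g n).1, 0) ξ := by
      rw [← shiftSymbol_add, Prod.mk_add_mk, zero_add, add_zero]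
    dsimp only
    rw [this, ← mul_sub, norm_mul, norm_mul, norm_shiftSymbol, one_mul]
  have h4 := h3.add h1
  rw [add_zero] at h4
  refine h4.congr fun n => ?_
  rw [← integral_add]
  · congr 1; ext ξ; ring
  · have := (integrable_shiftSymbol_mul hF (g n)).sub
      (integrable_shiftSymbol_mul hF' (0, (g n).2))
    refine this.congr (Eventually.of_forall fun ξ => ?_)
    simp only [Pi.sub_apply]; ring
  · exact integrable_shiftSymbol_mul hF' _

theorem tendsto_integral_shiftSymbol_mul {F : R3 → ℂ} (hF : Integrable F) :
    Tendsto (fun g => ∫ ξ, shiftSymbol g ξ * F ξ) (cocompact ShiftGroup) (𝓝 0) := by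
  rw [tendsto_iff_ultrafilter]
  intro 𝒰 h𝒰
  by_cases h1 : Tendsto (fun g : ShiftGroup => g.1) 𝒰 (cocompact ℝ)
  · refine tendsto_integral_shiftSymbol_mul_of_time hF (g := id) ?_
    exact (tendsto_norm_cocompact_atTop (E := ℝ)).comp h1
  · obtain ⟨a, ha⟩ := exists_tendsto_of_not_tendsto_cocompact h1
    refine tendsto_integral_shiftSymbol_mul_of_space hF (g := id) ha ?_
    by_contra h2
    obtain ⟨b, hb⟩ := exists_tendsto_of_not_tendsto_cocompact h2
    have h3 : (𝒰 : Filter ShiftGroup) ≤ 𝓝 (a, b) := ha.prodMk_nhds hb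
    have h4 := le_inf h3 h𝒰
    rw [(disjoint_nhds_cocompact ((a, b) : ShiftGroup)).eq_bot] at h4
    exact 𝒰.neBot.ne (le_bot_iff.1 h4)

/-- Bounded measurable Fourier symbols. -/
def IsBddSymbol (w : R3 → ℂ) : Prop := Measurable w ∧ ∃ C : ℝ, ∀ ξ, ‖w ξ‖ ≤ C

theorem IsBddSymbol.memLp_mul {w : R3 → ℂ} (hw : IsBddSymbol w) (g : L2) :
    MemLp (fun ξ => w ξ * g ξ) 2 volume := by
  obtain ⟨hm, C, hC⟩ := hw
  exact (Lp.memLp g).of_le_mul (c := C) (hm.aestronglyMeasurable.mul (Lp.memLp g).1)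
    (Eventually.of_forall fun ξ => by
      rw [norm_mul]; exact mul_le_mul_of_nonneg_right (hC ξ) (norm_nonneg _))

theorem norm_le_of_ae_le {f g : L2} {C : ℝ} (h : ∀ᵐ ξ, ‖f ξ‖ ≤ C * ‖g ξ‖) : ‖f‖ ≤ C * ‖g‖ :=
  Lp.norm_le_mul_norm_of_ae_le_mul h

/-- Multiplication by a bounded symbol. -/
noncomputable def mulOp (w : R3 → ℂ) (hw : IsBddSymbol w) : L2 →L[ℂ] L2 :=
  LinearMap.mkContinuous
    { toFun := fun g => (hw.memLp_mul g).toLp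
      map_add' := fun f g => by
        rw [← MemLp.toLp_add]
        refine MemLp.toLp_congr _ _ ?_
        filter_upwards [Lp.coeFn_add f g] with ξ h
        simp only [h, Pi.add_apply, mul_add]
      map_smul' := fun c g => by
        rw [RingHom.id_apply, ← MemLp.toLp_const_smul]
        refine MemLp.toLp_congr _ _ ?_
        filter_upwards [Lp.coeFn_smul c g] with ξ h
        simp only [h, Pi.smul_apply, smul_eq_mul]
        ring } hw.2.choose fun g => by
    refine norm_le_of_ae_le ?_
    filter_upwards [(hw.memLp_mul g).coeFn_toLp] with ξ h
    simp only [LinearMap.coe_mk, AddHom.coe_mk, h, norm_mul]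
    exact mul_le_mul_of_nonneg_right (hw.2.choose_spec ξ) (norm_nonneg _)

theorem coeFn_mulOp (w : R3 → ℂ) (hw : IsBddSymbol w) (g : L2) :
    mulOp w hw g =ᵐ[volume] fun ξ => w ξ * g ξ :=
  (hw.memLp_mul g).coeFn_toLp

theorem norm_mulOp_le {w : R3 → ℂ} (hw : IsBddSymbol w) {C : ℝ} (hC : ∀ ξ, ‖w ξ‖ ≤ C) (g : L2) :
    ‖mulOp w hw g‖ ≤ C * ‖g‖ := by
  refine norm_le_of_ae_le ?_
  filter_upwards [coeFn_mulOp w hw g] with ξ h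
  rw [h, norm_mul]
  exact mul_le_mul_of_nonneg_right (hC ξ) (norm_nonneg _)

theorem IsBddSymbol.mul {w v : R3 → ℂ} (hw : IsBddSymbol w) (hv : IsBddSymbol v) :
    IsBddSymbol fun ξ => w ξ * v ξ := by
  obtain ⟨hm, C, hC⟩ := hw
  obtain ⟨hm', C', hC'⟩ := hv
  refine ⟨hm.mul hm', C * C', fun ξ => ?_⟩
  rw [norm_mul]
  exact mul_le_mul (hC ξ) (hC' ξ) (norm_nonneg _) ((norm_nonneg _).trans (hC ξ))

theorem mulOp_mulOp {w v : R3 → ℂ} (hw : IsBddSymbol w) (hv : IsBddSymbol v) (g : L2) :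
    mulOp w hw (mulOp v hv g) = mulOp _ (hw.mul hv) g := by
  refine Lp.ext ?_
  filter_upwards [coeFn_mulOp w hw (mulOp v hv g), coeFn_mulOp v hv g,
    coeFn_mulOp _ (hw.mul hv) g] with ξ h1 h2 h3
  rw [h1, h2, h3, mul_assoc]

theorem mulOp_congr {w v : R3 → ℂ} (hw : IsBddSymbol w) (hv : IsBddSymbol v)
    (h : ∀ ξ, w ξ = v ξ) (g : L2) : mulOp w hw g = mulOp v hv g := by
  obtain rfl : w = v := funext h
  rfl

theorem mulOp_comm {w v : R3 → ℂ} (hw : IsBddSymbol w) (hv : IsBddSymbol v) (g : L2) :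
    mulOp w hw (mulOp v hv g) = mulOp v hv (mulOp w hw g) := by
  rw [mulOp_mulOp, mulOp_mulOp]
  exact mulOp_congr _ _ (fun ξ => mul_comm _ _) g

theorem isBddSymbol_one : IsBddSymbol fun _ => 1 := ⟨measurable_const, 1, by simp⟩

theorem mulOp_one (g : L2) : mulOp _ isBddSymbol_one g = g := by
  refine Lp.ext ?_
  filter_upwards [coeFn_mulOp _ isBddSymbol_one g] with ξ h
  rw [h, one_mul]

theorem isBddSymbol_shiftSymbol (g : ShiftGroup) : IsBddSymbol (shiftSymbol g) :=
  ⟨(continuous_shiftSymbol_right g).measurable, 1, fun ξ => (norm_shiftSymbol g ξ).le⟩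

theorem mulOp_shiftSymbol_neg (g : ShiftGroup) (f : L2) :
    mulOp _ (isBddSymbol_shiftSymbol (-g)) (mulOp _ (isBddSymbol_shiftSymbol g) f) = f := by
  rw [mulOp_mulOp]
  conv_rhs => rw [← mulOp_one f]
  exact mulOp_congr _ _ (shiftSymbol_neg_mul g) f

/-- Translation in time and space, on the Fourier side. -/
noncomputable def shiftOp (g : ShiftGroup) : L2 ≃ₗᵢ[ℂ] L2 where
  toLinearEquiv := LinearEquiv.ofLinearMap (mulOp _ (isBddSymbol_shiftSymbol g)).toLinearMap
    (mulOp _ (isBddSymbol_shiftSymbol (-g))).toLinearMap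
    (LinearMap.ext fun f => by
      have := mulOp_shiftSymbol_neg (-g) f
      rw [mulOp_congr (isBddSymbol_shiftSymbol (- -g)) (isBddSymbol_shiftSymbol g)
        (fun ξ => by rw [neg_neg])] at this
      exact this)
    (LinearMap.ext fun f => mulOp_shiftSymbol_neg g f)
  norm_map' := fun f => by
    have h1 : ∀ (g : ShiftGroup) (f : L2), ‖mulOp _ (isBddSymbol_shiftSymbol g) f‖ ≤ ‖f‖ :=
      fun g f => by
        simpa using norm_mulOp_le (isBddSymbol_shiftSymbol g) (fun ξ => (norm_shiftSymbol g ξ).le) f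
    refine le_antisymm (h1 g f) ?_
    have := h1 (-g) (mulOp _ (isBddSymbol_shiftSymbol g) f)
    rwa [mulOp_shiftSymbol_neg] at this

theorem shiftOp_eq_mulOp (g : ShiftGroup) (f : L2) :
    shiftOp g f = mulOp _ (isBddSymbol_shiftSymbol g) f := rfl

theorem coeFn_shiftOp (g : ShiftGroup) (f : L2) :
    shiftOp g f =ᵐ[volume] fun ξ => shiftSymbol g ξ * f ξ := coeFn_mulOp _ (isBddSymbol_shiftSymbol g) f

theorem mulOp_shiftOp {w : R3 → ℂ} (hw : IsBddSymbol w) (g : ShiftGroup) (f : L2) :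
    mulOp w hw (shiftOp g f) = shiftOp g (mulOp w hw f) :=
  mulOp_comm hw (isBddSymbol_shiftSymbol g) f

theorem integrable_conj_mul (u v : L2) : Integrable fun ξ => (starRingEnd ℂ) (u ξ) * v ξ := by
  have := L2.integrable_inner (𝕜 := ℂ) u v
  refine this.congr (Eventually.of_forall fun ξ => ?_)
  simp [mul_comm]

theorem inner_eq_integral (u v : L2) : inner ℂ u v = ∫ ξ, (starRingEnd ℂ) (u ξ) * v ξ := by
  rw [L2.inner_def]
  refine integral_congr_ae (Eventually.of_forall fun ξ => ?_)
  simp [mul_comm]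

theorem inner_shiftOp (u v : L2) (g : ShiftGroup) :
    inner ℂ u (shiftOp g v) = ∫ ξ, shiftSymbol g ξ * ((starRingEnd ℂ) (u ξ) * v ξ) := by
  rw [inner_eq_integral]
  refine integral_congr_ae ?_
  filter_upwards [coeFn_shiftOp g v] with ξ h
  rw [h]; ring

theorem shiftOp_add (a b : ShiftGroup) (f : L2) : shiftOp (a + b) f = shiftOp a (shiftOp b f) := by
  rw [shiftOp_eq_mulOp, shiftOp_eq_mulOp, shiftOp_eq_mulOp, mulOp_mulOp]
  exact mulOp_congr _ _ (shiftSymbol_add a b) f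

theorem continuous_shiftOp (f : L2) : Continuous fun g => shiftOp g f := by
  rw [continuous_iff_continuousAt]
  intro a
  rw [ContinuousAt, tendsto_iff_norm_sub_tendsto_zero]
  have h1 : ∀ g, ‖shiftOp g f - shiftOp a f‖ ^ 2 =
      2 * ‖f‖ ^ 2 - 2 * (inner ℂ (shiftOp a f) (shiftOp g f)).re := by
    intro g
    rw [@norm_sub_rev, @norm_sub_sq ℂ, LinearIsometryEquiv.norm_map, LinearIsometryEquiv.norm_map]
    simp only [RCLike.re_to_complex]
    ring
  have h2 : Continuous fun g => ‖shiftOp g f - shiftOp a f‖ ^ 2 := by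
    simp only [h1, inner_shiftOp]
    have := continuous_integral_shiftSymbol_mul (integrable_conj_mul (shiftOp a f) f)
    fun_prop
  have h3 := ((h2.tendsto a).sqrt)
  simpa using h3

theorem isMixingRep_shiftOp : IsMixingRep shiftOp where
  map_add := shiftOp_add
  continuous := continuous_shiftOp
  decay := fun u v => by
    simp only [inner_shiftOp]
    exact tendsto_integral_shiftSymbol_mul (integrable_conj_mul u v)

/-- Pairs of square integrable functions. -/
abbrev L2Pair : Type := PiLp 2 fun _ : Fin 2 => L2

/-- Simultaneous translation of both components. -/
noncomputable def pairShiftOp (g : ShiftGroup) : L2Pair ≃ₗᵢ[ℂ] L2Pair :=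
  LinearIsometryEquiv.piLpCongrRight 2 fun _ => shiftOp g

theorem pairShiftOp_apply (g : ShiftGroup) (f : L2Pair) (i : Fin 2) :
    pairShiftOp g f i = shiftOp g (f i) := rfl

theorem isMixingRep_pairShiftOp : IsMixingRep pairShiftOp where
  map_add := fun a b f => PiLp.ext fun i => by
    simp only [pairShiftOp_apply, shiftOp_add]
  continuous := fun f => by
    refine (PiLp.continuous_toLp 2 _).comp (continuous_pi fun i => ?_)
    exact continuous_shiftOp (f i)
  decay := fun u v => by
    simp only [PiLp.inner_apply, pairShiftOp_apply]
    simpa only [Finset.sum_const_zero] using tendsto_finsetSum (Finset.univ : Finset (Fin 2))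
      fun i _ => isMixingRep_shiftOp.decay (u i) (v i)

theorem WeakTendsto.apply {ι : Type*} {l : Filter ι} {f : ι → L2Pair} {x : L2Pair}
    (h : WeakTendsto f l x) (i : Fin 2) : WeakTendsto (fun n => f n i) l (x i) := fun v => by
  have h1 : ∀ y : L2Pair, inner ℂ (PiLp.single 2 i v : L2Pair) y = inner ℂ v (y i) := fun y => by
    rw [PiLp.inner_apply, Finset.sum_eq_single i]
    · simp
    · intro j _ hj
      simp [hj]
    · simp
  simpa only [h1] using h (PiLp.single 2 i v)

/-- The pointwise inverse Fourier transform agrees with the `L²` one on `L¹ ∩ L²`. -/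
theorem coeFn_fourierInv {Z : L2} (hZ : Integrable Z) :
    (𝓕⁻ Z : L2) =ᵐ[volume] fun x => ∫ ξ, shiftSymbol (0, -x) ξ * Z ξ := by
  have hpt : (fun x => ∫ ξ, shiftSymbol (0, -x) ξ * Z ξ) = (𝓕⁻ (Z : R3 → ℂ) : R3 → ℂ) := by
    ext x
    rw [Real.fourierInv_eq']
    refine integral_congr_ae (Eventually.of_forall fun ξ => ?_)
    simp only [shiftSymbol, phase, smul_eq_mul, inner_neg_left]
    rw [real_inner_comm]
    congr 3
    push_cast
    ring
  have hc : Continuous fun x : R3 => ∫ ξ, shiftSymbol (0, -x) ξ * Z ξ :=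
    (continuous_integral_shiftSymbol_mul hZ).comp
      (by fun_prop : Continuous fun x : R3 => ((0, -x) : ShiftGroup))
  refine ae_eq_of_integral_contDiff_smul_eq ((Lp.memLp (𝓕⁻ Z : L2)).locallyIntegrable (by norm_num))
    hc.locallyIntegrable fun g hg hgc => ?_
  have hg₁ : HasCompactSupport (Complex.ofRealCLM ∘ g) := hgc.comp_left rfl
  have hg₂ : ContDiff ℝ (⊤ : ℕ∞) (Complex.ofRealCLM ∘ g) := by fun_prop
  set G : SchwartzMap R3 ℂ := hg₁.toSchwartzMap hg₂ with hG
  have hGx : ∀ x, G x = (g x : ℂ) := fun x => rfl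
  have h1 := congrArg (fun T => T G) (Lp.fourierInv_toTemperedDistribution_eq Z)
  simp only [TemperedDistribution.fourierInv_apply, Lp.toTemperedDistribution_apply] at h1
  have h2 : ∫ x, (𝓕⁻ (G : R3 → ℂ) : R3 → ℂ) x • Z x = ∫ x, G x • (𝓕⁻ (Z : R3 → ℂ) : R3 → ℂ) x := by
    have := VectorFourier.integral_fourierIntegral_smul_eq_flip (L := -innerₗ R3)
      Real.continuous_fourierChar (by simpa using! continuous_inner.neg)
      G.integrable hZ (μ := volume) (ν := volume)
    have hflip : (-innerₗ R3 : R3 →ₗ[ℝ] R3 →ₗ[ℝ] ℝ).flip = -innerₗ R3 := by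
      ext x y; simp [real_inner_comm]
    rw [hflip] at this
    exact this
  have h3 : ∫ x, (𝓕⁻ G) x • Z x = ∫ x, G x • (𝓕⁻ (Z : R3 → ℂ) : R3 → ℂ) x := by
    rw [← h2, SchwartzMap.fourierInv_coe]
  rw [h3] at h1
  simp only [fun x => congrFun hpt x]
  simpa [hGx] using h1.symm

/-- A space translation is a modulation on the Fourier side. -/
theorem spaceShift_fourierInv (y : R3) (Z : L2) :
    spaceShift y (𝓕⁻ Z) = 𝓕⁻ (shiftOp (0, y) Z) := by
  refine DenseRange.induction_on (p := fun Z : L2 => spaceShift y (𝓕⁻ Z) = 𝓕⁻ (shiftOp (0, y) Z))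
    (SchwartzMap.denseRange_toLpCLM (E := R3) (F := ℂ) (μ := volume) (p := 2)
      ENNReal.ofNat_ne_top) Z ?_ ?_
  · refine isClosed_eq ?_ ?_
    · exact (Lp.isometry_compMeasurePreserving _).continuous.comp
        (Lp.fourierTransformₗᵢ R3 ℂ).symm.continuous
    · exact (Lp.fourierTransformₗᵢ R3 ℂ).symm.continuous.comp (shiftOp (0, y)).continuous
  · intro f
    set Z : L2 := SchwartzMap.toLpCLM ℝ ℂ 2 volume f with hZdef
    have hZf : Z =ᵐ[volume] f := SchwartzMap.coeFn_toLp f 2 volume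
    have hZ : Integrable Z := f.integrable.congr hZf.symm
    have hS : Integrable (shiftOp (0, y) Z) :=
      (integrable_shiftSymbol_mul hZ (0, y)).congr (coeFn_shiftOp (0, y) Z).symm
    refine Lp.ext ?_
    have h1 := Lp.coeFn_compMeasurePreserving (𝓕⁻ Z : L2)
      (measurePreserving_sub_right (volume : Measure R3) y)
    have h2 := (measurePreserving_sub_right (volume : Measure R3) y).quasiMeasurePreserving.ae_eq_comp
      (coeFn_fourierInv hZ)
    filter_upwards [h1, h2, coeFn_fourierInv hS] with x h3 h4 h5
    change (Lp.compMeasurePreserving _ _ (𝓕⁻ Z : L2)) x = _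
    rw [h3, h4, h5, Function.comp_apply]
    refine integral_congr_ae ?_
    filter_upwards [coeFn_shiftOp (0, y) Z] with ξ h6
    rw [h6, ← mul_assoc, ← shiftSymbol_add]
    congr 2
    ext1 <;> simp [sub_eq_add_neg, add_comm]

/-- The Schrödinger group is a modulation on the Fourier side. -/
theorem schrodinger_fourierInv (t : ℝ) (Z : L2) :
    schrodinger t (𝓕⁻ Z) = 𝓕⁻ (shiftOp (t, 0) Z) := by
  rw [schrodinger]
  congr 1
  refine Lp.ext ?_
  have hFZ : 𝓕 (𝓕⁻ Z) = Z := FourierTransform.fourier_fourierInv_eq Z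
  filter_upwards [(memLp_schrodingerSymbol_mul t (𝓕 (𝓕⁻ Z))).coeFn_toLp, coeFn_shiftOp (t, 0) Z]
    with ξ h1 h2
  rw [h1, h2, hFZ]
  congr 1
  simp [schrodingerSymbol, shiftSymbol, phase]

/-- The weight `1 + |2πξ|`. -/
noncomputable def freqWeight (ξ : R3) : ℝ := 1 + ‖(2 * Real.pi) • ξ‖

theorem one_le_freqWeight (ξ : R3) : 1 ≤ freqWeight ξ := by
  unfold freqWeight; linarith [norm_nonneg ((2 * Real.pi) • ξ)]

theorem freqWeight_pos (ξ : R3) : 0 < freqWeight ξ := one_pos.trans_le (one_le_freqWeight ξ)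

theorem continuous_freqWeight : Continuous freqWeight := by
  unfold freqWeight; fun_prop

/-- The symbol `(1 + |2πξ|)⁻¹`. -/
noncomputable def besselSymbol (ξ : R3) : ℂ := ((freqWeight ξ)⁻¹ : ℝ)

theorem continuous_besselSymbol : Continuous besselSymbol := by
  unfold besselSymbol
  exact Complex.continuous_ofReal.comp
    (continuous_freqWeight.inv₀ fun ξ => (freqWeight_pos ξ).ne')

theorem norm_besselSymbol (ξ : R3) : ‖besselSymbol ξ‖ = (freqWeight ξ)⁻¹ := by
  rw [besselSymbol, Complex.norm_real, Real.norm_of_nonneg (inv_nonneg.2 (freqWeight_pos ξ).le)]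

theorem norm_besselSymbol_le_one (ξ : R3) : ‖besselSymbol ξ‖ ≤ 1 := by
  rw [norm_besselSymbol]; exact inv_le_one_of_one_le₀ (one_le_freqWeight ξ)

theorem isBddSymbol_besselSymbol : IsBddSymbol besselSymbol :=
  ⟨continuous_besselSymbol.measurable, 1, norm_besselSymbol_le_one⟩

/-- The potential operator parametrising `H¹` by `L²`, starting on the Fourier side. -/
noncomputable def bessel : L2 →L[ℂ] L2 :=
  (Lp.fourierTransformₗᵢ R3 ℂ).symm.toContinuousLinearEquiv.toContinuousLinearMap ∘L
    mulOp besselSymbol isBddSymbol_besselSymbol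

theorem bessel_apply (Y : L2) :
    bessel Y = 𝓕⁻ (mulOp besselSymbol isBddSymbol_besselSymbol Y) := rfl

theorem fourier_bessel (Y : L2) :
    𝓕 (bessel Y) = mulOp besselSymbol isBddSymbol_besselSymbol Y :=
  FourierTransform.fourier_fourierInv_eq _

theorem schrodinger_bessel (t : ℝ) (Y : L2) :
    schrodinger t (bessel Y) = bessel (shiftOp (t, 0) Y) := by
  rw [bessel_apply, schrodinger_fourierInv, ← mulOp_shiftOp, bessel_apply]

theorem spaceShift_bessel (y : R3) (Y : L2) :
    spaceShift y (bessel Y) = bessel (shiftOp (0, y) Y) := by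
  rw [bessel_apply, spaceShift_fourierInv, ← mulOp_shiftOp, bessel_apply]

theorem spaceShift_schrodinger_bessel (t : ℝ) (y : R3) (Y : L2) :
    spaceShift y (schrodinger t (bessel Y)) = bessel (shiftOp (t, y) Y) := by
  rw [schrodinger_bessel, spaceShift_bessel, ← shiftOp_add, Prod.mk_add_mk, zero_add, add_zero]

/-- The constant relating `L²` norms in the two normalisations of the frequency. -/
noncomputable def dilationConst : ℝ≥0∞ :=
  ENNReal.ofReal |(((2 * Real.pi)⁻¹ : ℝ) ^ 3)⁻¹| ^ (1 / (2 : ℝ≥0∞)).toReal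

theorem dilationConst_ne_zero : dilationConst ≠ 0 := by
  unfold dilationConst
  have : 0 < |(((2 * Real.pi)⁻¹ : ℝ) ^ 3)⁻¹| := by positivity
  exact (ENNReal.rpow_pos (ENNReal.ofReal_pos.2 this) ENNReal.ofReal_ne_top).ne'

theorem dilationConst_ne_top : dilationConst ≠ ∞ :=
  ENNReal.rpow_ne_top_of_nonneg ENNReal.toReal_nonneg ENNReal.ofReal_ne_top

theorem eLpNorm_comp_dilation (F : R3 → ℂ) :
    eLpNorm (fun ξ => F ((2 * Real.pi)⁻¹ • ξ)) 2 volume = dilationConst * eLpNorm F 2 volume := by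
  have h0 : ((2 * Real.pi)⁻¹ : ℝ) ≠ 0 := by positivity
  have h1 := (Homeomorph.smulOfNeZero ((2 * Real.pi)⁻¹ : ℝ) h0 (α := R3)).measurableEmbedding
  have h2 := h1.eLpNorm_map_measure (g := F) (p := 2) (μ := volume)
  have h3 : Measure.map (Homeomorph.smulOfNeZero ((2 * Real.pi)⁻¹ : ℝ) h0 (α := R3)) volume =
      ENNReal.ofReal |(((2 * Real.pi)⁻¹ : ℝ) ^ 3)⁻¹| • (volume : Measure R3) := by
    have := Measure.map_addHaar_smul (volume : Measure R3) h0
    simp only [finrank_euclideanSpace, Fintype.card_fin] at this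
    exact this
  rw [h3, eLpNorm_smul_measure_of_ne_top (by norm_num)] at h2
  exact h2.symm

theorem eLpNorm_coe_eq (g : L2) : eLpNorm g 2 volume = ENNReal.ofReal ‖g‖ := by
  rw [Lp.norm_def, ENNReal.ofReal_toReal (Lp.eLpNorm_ne_top g)]

theorem sobolevNorm_one_eq (f : L2) : sobolevNorm 1 f =
    dilationConst * eLpNorm (fun ξ => ((freqWeight ξ : ℝ) : ℂ) * (𝓕 f : L2) ξ) 2 volume := by
  rw [← eLpNorm_comp_dilation, sobolevNorm]
  congr 1
  ext ξ
  rw [hat, freqWeight, Real.rpow_one, smul_smul, mul_inv_cancel₀ (by positivity), one_smul]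

theorem homSobolevNorm_eq (s : ℝ) (f : L2) : homSobolevNorm s f = dilationConst *
    eLpNorm (fun ξ => ((‖(2 * Real.pi) • ξ‖ ^ s : ℝ) : ℂ) * (𝓕 f : L2) ξ) 2 volume := by
  rw [← eLpNorm_comp_dilation, homSobolevNorm]
  congr 1
  ext ξ
  rw [hat, smul_smul, mul_inv_cancel₀ (by positivity), one_smul]

theorem sobolevNorm_bessel (Y : L2) :
    sobolevNorm 1 (bessel Y) = dilationConst * ENNReal.ofReal ‖Y‖ := by
  rw [sobolevNorm_one_eq, fourier_bessel, ← eLpNorm_coe_eq]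
  congr 1
  refine eLpNorm_congr_ae ?_
  filter_upwards [coeFn_mulOp _ isBddSymbol_besselSymbol Y] with ξ h
  rw [h, besselSymbol, ← mul_assoc, ← Complex.ofReal_mul,
    mul_inv_cancel₀ (freqWeight_pos ξ).ne', Complex.ofReal_one, one_mul]

theorem memH1_bessel (Y : L2) : MemH1 (bessel Y) := by
  rw [MemH1, sobolevNorm_bessel]
  exact ENNReal.mul_lt_top dilationConst_ne_top.lt_top ENNReal.ofReal_lt_top

theorem MemH1.exists_eq_bessel {f : L2} (hf : MemH1 f) : ∃ Y, f = bessel Y := by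
  rw [MemH1, sobolevNorm_one_eq] at hf
  have h1 : eLpNorm (fun ξ => ((freqWeight ξ : ℝ) : ℂ) * (𝓕 f : L2) ξ) 2 volume < ∞ :=
    ENNReal.lt_top_of_mul_ne_top_right hf.ne dilationConst_ne_zero
  have h2 : MemLp (fun ξ => ((freqWeight ξ : ℝ) : ℂ) * (𝓕 f : L2) ξ) 2 volume :=
    ⟨(Complex.continuous_ofReal.comp continuous_freqWeight).aestronglyMeasurable.mul
      (Lp.memLp _).1, h1⟩
  refine ⟨h2.toLp, ?_⟩
  have h3 : mulOp besselSymbol isBddSymbol_besselSymbol h2.toLp = 𝓕 f := by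
    refine Lp.ext ?_
    filter_upwards [coeFn_mulOp _ isBddSymbol_besselSymbol h2.toLp, h2.coeFn_toLp] with ξ h4 h5
    rw [h4, h5, besselSymbol, ← mul_assoc, ← Complex.ofReal_mul,
      inv_mul_cancel₀ (freqWeight_pos ξ).ne', Complex.ofReal_one, one_mul]
  rw [bessel_apply, h3]
  exact (FourierTransform.fourierInv_fourier_eq f).symm

theorem BoundedInH1.exists_eq_bessel {f : ℕ → L2} (hf : BoundedInH1 f) :
    ∃ (Y : ℕ → L2) (C : ℝ), (∀ n, f n = bessel (Y n)) ∧ ∀ n, ‖Y n‖ ≤ C := by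
  obtain ⟨C, hC⟩ := hf
  have h1 : ∀ n, ∃ Y, f n = bessel Y := fun n =>
    MemH1.exists_eq_bessel ((hC n).trans_lt ENNReal.coe_lt_top)
  choose Y hY using h1
  refine ⟨Y, (dilationConst⁻¹ * C).toReal, hY, fun n => ?_⟩
  have h2 := hC n
  rw [hY n, sobolevNorm_bessel] at h2
  have h3 : dilationConst⁻¹ * C ≠ ∞ :=
    ENNReal.mul_ne_top (ENNReal.inv_ne_top.2 dilationConst_ne_zero) ENNReal.coe_ne_top
  rw [← ENNReal.ofReal_le_iff_le_toReal h3, mul_comm, ← div_eq_mul_inv,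
    ENNReal.le_div_iff_mul_le (Or.inl dilationConst_ne_zero) (Or.inl dilationConst_ne_top), mul_comm]
  exact h2

/-- The symbol `|2πξ|^s (1 + |2πξ|)⁻¹`. -/
noncomputable def rieszBesselSymbol (s : ℝ) (ξ : R3) : ℂ :=
  ((‖(2 * Real.pi) • ξ‖ ^ s : ℝ) : ℂ) * besselSymbol ξ

theorem isBddSymbol_rieszBesselSymbol {s : ℝ} (hs : s ∈ Set.Icc (0 : ℝ) 1) :
    IsBddSymbol (rieszBesselSymbol s) := by
  refine ⟨?_, 1, fun ξ => ?_⟩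
  · have : Measurable fun ξ : R3 => ‖(2 * Real.pi) • ξ‖ ^ s := by fun_prop
    exact (Complex.measurable_ofReal.comp this).mul continuous_besselSymbol.measurable
  · rw [rieszBesselSymbol, norm_mul, norm_besselSymbol, Complex.norm_real,
      Real.norm_of_nonneg (by positivity), ← div_eq_mul_inv, div_le_one (freqWeight_pos ξ)]
    have h0 := norm_nonneg ((2 * Real.pi) • ξ)
    calc ‖(2 * Real.pi) • ξ‖ ^ s ≤ (freqWeight ξ) ^ s :=
          Real.rpow_le_rpow h0 (by unfold freqWeight; linarith) hs.1
      _ ≤ (freqWeight ξ) ^ (1 : ℝ) := Real.rpow_le_rpow_of_exponent_le (one_le_freqWeight ξ) hs.2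
      _ = freqWeight ξ := Real.rpow_one _

theorem toReal_homSobolevNorm_bessel {s : ℝ} (hs : s ∈ Set.Icc (0 : ℝ) 1) (Y : L2) :
    (homSobolevNorm s (bessel Y)).toReal =
      dilationConst.toReal * ‖mulOp _ (isBddSymbol_rieszBesselSymbol hs) Y‖ := by
  rw [homSobolevNorm_eq, ENNReal.toReal_mul, Lp.norm_def, fourier_bessel]
  congr 2
  refine eLpNorm_congr_ae ?_
  filter_upwards [coeFn_mulOp _ isBddSymbol_besselSymbol Y,
    coeFn_mulOp _ (isBddSymbol_rieszBesselSymbol hs) Y] with ξ h1 h2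
  rw [h1, h2, rieszBesselSymbol, mul_assoc]

/-- The decay rate of the damped Schrödinger kernel. -/
noncomputable def dampedDecay (ε τ : ℝ) : ℝ := (4 * Real.pi * √(ε ^ 2 + τ ^ 2)) ^ (-(3 / 2) : ℝ)

theorem measurable_dampedDecay (ε : ℝ) : Measurable (dampedDecay ε) := by
  unfold dampedDecay; fun_prop

theorem integrable_japanese_bracket :
    Integrable fun τ : ℝ => (1 + τ ^ 2) ^ (-(3 / 2) / 2 : ℝ) := by
  have := integrable_rpow_neg_one_add_norm_sq (E := ℝ) (μ := volume) (r := 3 / 2) (by norm_num)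
  simpa only [Real.norm_eq_abs, sq_abs] using this

theorem dampedDecay_le {ε : ℝ} (hε : 0 < ε) (τ : ℝ) :
    dampedDecay ε τ ≤ ε ^ (-(3 / 2) : ℝ) * (1 + (ε⁻¹ * τ) ^ 2) ^ (-(3 / 2) / 2 : ℝ) := by
  have h1 : ε ^ 2 + τ ^ 2 = ε ^ 2 * (1 + (ε⁻¹ * τ) ^ 2) := by field_simp
  have h2 : √(ε ^ 2 + τ ^ 2) = ε * (1 + (ε⁻¹ * τ) ^ 2) ^ (1 / 2 : ℝ) := by
    rw [h1, Real.sqrt_mul (sq_nonneg ε), Real.sqrt_sq hε.le, Real.sqrt_eq_rpow]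
  have h3 : 0 < 1 + (ε⁻¹ * τ) ^ 2 := by positivity
  have h4 : ε ^ (-(3 / 2) : ℝ) * (1 + (ε⁻¹ * τ) ^ 2) ^ (-(3 / 2) / 2 : ℝ) =
      (√(ε ^ 2 + τ ^ 2)) ^ (-(3 / 2) : ℝ) := by
    rw [h2, Real.mul_rpow hε.le (by positivity), ← Real.rpow_mul h3.le]
    norm_num
  rw [h4, dampedDecay]
  have h5 : 0 < √(ε ^ 2 + τ ^ 2) := Real.sqrt_pos.2 (by positivity)
  refine Real.rpow_le_rpow_of_nonpos h5 ?_ (by norm_num)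
  nlinarith [Real.pi_gt_three]

theorem lintegral_dampedDecay_le {ε : ℝ} (hε : 0 < ε) :
    ∫⁻ τ, ENNReal.ofReal (dampedDecay ε τ) ≤
      ENNReal.ofReal (∫ τ : ℝ, (1 + τ ^ 2) ^ (-(3 / 2) / 2 : ℝ)) *
        ENNReal.ofReal (ε ^ (-(1 / 2) : ℝ)) := by
  have hi := (integrable_japanese_bracket.comp_mul_left' (inv_ne_zero hε.ne')).const_mul
    (ε ^ (-(3 / 2) : ℝ))
  calc ∫⁻ τ, ENNReal.ofReal (dampedDecay ε τ)
      ≤ ∫⁻ τ, ENNReal.ofReal (ε ^ (-(3 / 2) : ℝ) * (1 + (ε⁻¹ * τ) ^ 2) ^ (-(3 / 2) / 2 : ℝ)) :=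
        lintegral_mono fun τ => ENNReal.ofReal_le_ofReal (dampedDecay_le hε τ)
    _ = ENNReal.ofReal
        (∫ τ, ε ^ (-(3 / 2) : ℝ) * (1 + (ε⁻¹ * τ) ^ 2) ^ (-(3 / 2) / 2 : ℝ)) :=
        (ofReal_integral_eq_lintegral_ofReal hi (Eventually.of_forall fun τ => by positivity)).symm
    _ = _ := by
        rw [integral_const_mul,
          Measure.integral_comp_mul_left (fun τ : ℝ => (1 + τ ^ 2) ^ (-(3 / 2) / 2 : ℝ)) ε⁻¹,
          ← ENNReal.ofReal_mul (integral_nonneg fun τ => by positivity)]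
        congr 1
        have h1 : ε ^ (-(3 / 2) : ℝ) * ε = ε ^ (-(1 / 2) : ℝ) := by
          conv_lhs => rw [← Real.rpow_one ε, ← Real.rpow_mul hε.le, ← Real.rpow_add hε]
          norm_num
        rw [inv_inv, abs_of_pos hε, smul_eq_mul, ← mul_assoc, h1, mul_comm]

theorem lintegral_prod_mul_mul_le {f : ℝ → ℝ≥0∞} (hf : Measurable f) {k : ℝ → ℝ≥0∞}
    (hk : Measurable k) :
    ∫⁻ p : ℝ × ℝ, f p.1 * f p.2 * k (p.1 - p.2) ≤ 2 * (∫⁻ t, f t ^ 2) * ∫⁻ τ, k τ := by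
  have hxy : ∀ x y : ℝ≥0∞, x * y ≤ x ^ 2 + y ^ 2 := fun x y => by
    rcases le_total x y with h | h
    · calc x * y ≤ y * y := mul_le_mul_left h y
        _ = y ^ 2 := (sq y).symm
        _ ≤ _ := le_add_self
    · calc x * y ≤ x * x := mul_le_mul_right h x
        _ = x ^ 2 := (sq x).symm
        _ ≤ _ := le_self_add
  have hk' : Measurable fun p : ℝ × ℝ => k (p.1 - p.2) :=
    hk.comp (measurable_fst.sub measurable_snd)
  have h1 : ∫⁻ p : ℝ × ℝ, f p.1 ^ 2 * k (p.1 - p.2) = (∫⁻ t, f t ^ 2) * ∫⁻ τ, k τ := by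
    rw [Measure.volume_eq_prod, lintegral_prod]
    · simp only
      rw [← lintegral_mul_const _ (by fun_prop)]
      refine lintegral_congr fun t => ?_
      rw [lintegral_const_mul _ (by fun_prop), lintegral_sub_left_eq_self k t]
    · exact Measurable.aemeasurable (by fun_prop)
  have h2 : ∫⁻ p : ℝ × ℝ, f p.2 ^ 2 * k (p.1 - p.2) = (∫⁻ t, f t ^ 2) * ∫⁻ τ, k τ := by
    rw [Measure.volume_eq_prod, lintegral_prod_symm]
    · simp only
      rw [← lintegral_mul_const _ (by fun_prop)]
      refine lintegral_congr fun t => ?_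
      rw [lintegral_const_mul _ (by fun_prop), lintegral_sub_right_eq_self k t]
    · exact Measurable.aemeasurable (by fun_prop)
  calc ∫⁻ p : ℝ × ℝ, f p.1 * f p.2 * k (p.1 - p.2)
      ≤ ∫⁻ p : ℝ × ℝ, (f p.1 ^ 2 * k (p.1 - p.2) + f p.2 ^ 2 * k (p.1 - p.2)) :=
        lintegral_mono fun p => by
          rw [← add_mul]; exact mul_le_mul_left (hxy _ _) _
    _ = _ := by
        rw [lintegral_add_left (by fun_prop), h1, h2]
        ring

section TTStar

variable {a : ℝ → ℂ} {γ : ℝ → ShiftGroup}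

/-- The adjoint of the evaluation along the path `γ`, on the Fourier side. -/
noncomputable def pathAdjoint (a : ℝ → ℂ) (γ : ℝ → ShiftGroup) (ξ : R3) : ℂ :=
  ∫ t, a t * shiftSymbol (γ t) ξ

theorem measurable_shiftSymbol_path (hγ : Measurable γ) :
    Measurable fun p : R3 × ℝ => shiftSymbol (γ p.2) p.1 :=
  continuous_shiftSymbol.measurable.comp ((hγ.comp measurable_snd).prodMk measurable_fst)

theorem stronglyMeasurable_pathAdjoint (ha : Measurable a) (hγ : Measurable γ) :
    StronglyMeasurable (pathAdjoint a γ) := by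
  refine StronglyMeasurable.integral_prod_right (f := fun ξ t => a t * shiftSymbol (γ t) ξ) ?_
  exact ((ha.comp measurable_snd).mul (measurable_shiftSymbol_path hγ)).stronglyMeasurable

theorem norm_sq_pathAdjoint (ξ : R3) : ((‖pathAdjoint a γ ξ‖ ^ 2 : ℝ) : ℂ) =
    ∫ p : ℝ × ℝ, a p.1 * (starRingEnd ℂ) (a p.2) * shiftSymbol (γ p.1 - γ p.2) ξ := by
  have h1 : ((‖pathAdjoint a γ ξ‖ ^ 2 : ℝ) : ℂ) =
      pathAdjoint a γ ξ * (starRingEnd ℂ) (pathAdjoint a γ ξ) := by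
    rw [Complex.mul_conj, Complex.normSq_eq_norm_sq]
  rw [h1, pathAdjoint, ← integral_conj, ← integral_prod_mul, Measure.volume_eq_prod]
  refine integral_congr_ae (Eventually.of_forall fun p => ?_)
  simp only [map_mul, conj_shiftSymbol, sub_eq_add_neg, shiftSymbol_add]
  ring

theorem integrable_exp_neg_mul_sq {ε : ℝ} (hε : 0 < ε) :
    Integrable fun ξ : R3 => Real.exp (-(ε * ‖(2 * Real.pi) • ξ‖ ^ 2)) := by
  have := (integrable_exp_mul_shiftSymbol hε 0).norm
  refine this.congr (Eventually.of_forall fun ξ => ?_)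
  simp only [norm_mul, norm_shiftSymbol, mul_one, Complex.norm_real, Real.norm_eq_abs,
    Real.abs_exp]

theorem lintegral_exp_mul_pathAdjoint_le (ha : Measurable a) (hai : Integrable a)
    (hγ : Measurable γ) (hγt : ∀ t, (γ t).1 = t) {ε : ℝ} (hε : 0 < ε) :
    ∫⁻ ξ, ENNReal.ofReal (Real.exp (-(ε * ‖(2 * Real.pi) • ξ‖ ^ 2))) * ‖pathAdjoint a γ ξ‖ₑ ^ 2 ≤
      2 * (∫⁻ t, ‖a t‖ₑ ^ 2) * ∫⁻ τ, ENNReal.ofReal (dampedDecay ε τ) := by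
  set w : R3 → ℝ := fun ξ => Real.exp (-(ε * ‖(2 * Real.pi) • ξ‖ ^ 2)) with hw
  have hwi : Integrable w := integrable_exp_neg_mul_sq hε
  let B : R3 → ℝ × ℝ → ℂ := fun ξ p =>
    (w ξ : ℂ) * (a p.1 * (starRingEnd ℂ) (a p.2) * shiftSymbol (γ p.1 - γ p.2) ξ)
  have hBm : Measurable (Function.uncurry B) := by
    have h1 : Measurable fun q : R3 × (ℝ × ℝ) => shiftSymbol (γ q.2.1 - γ q.2.2) q.1 :=
      continuous_shiftSymbol.measurable.comp
        (((hγ.comp (measurable_fst.comp measurable_snd)).sub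
          (hγ.comp (measurable_snd.comp measurable_snd))).prodMk measurable_fst)
    have h2 : Measurable fun q : R3 × (ℝ × ℝ) => (w q.1 : ℂ) := by fun_prop
    have h3 : Measurable fun q : R3 × (ℝ × ℝ) => a q.2.1 := by fun_prop
    have h4 : Measurable fun q : R3 × (ℝ × ℝ) => (starRingEnd ℂ) (a q.2.2) :=
      Complex.continuous_conj.measurable.comp (by fun_prop)
    exact h2.mul ((h3.mul h4).mul h1)
  have hBi : Integrable (Function.uncurry B) (volume.prod volume) := by
    have h1 : Integrable (fun q : R3 × (ℝ × ℝ) => w q.1 * (‖a q.2.1‖ * ‖a q.2.2‖))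
        (volume.prod volume) := hwi.mul_prod (hai.norm.mul_prod hai.norm)
    refine h1.mono hBm.aestronglyMeasurable (Eventually.of_forall fun q => ?_)
    simp only [Function.uncurry, B, norm_mul, norm_shiftSymbol, mul_one, RCLike.norm_conj,
      Complex.norm_real, norm_norm, le_refl]
  have hR : ∀ ξ, ((w ξ * ‖pathAdjoint a γ ξ‖ ^ 2 : ℝ) : ℂ) = ∫ p, B ξ p := fun ξ => by
    rw [Complex.ofReal_mul, norm_sq_pathAdjoint, integral_const_mul]
  have hRi : Integrable fun ξ => w ξ * ‖pathAdjoint a γ ξ‖ ^ 2 := by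
    have h1 : Integrable fun ξ => ((w ξ * ‖pathAdjoint a γ ξ‖ ^ 2 : ℝ) : ℂ) := by
      simp only [hR]; exact hBi.integral_prod_left
    exact h1.re.congr (Eventually.of_forall fun ξ => Complex.ofReal_re _)
  have h1 : ∀ ξ, ENNReal.ofReal (w ξ) * ‖pathAdjoint a γ ξ‖ₑ ^ 2 =
      ENNReal.ofReal (w ξ * ‖pathAdjoint a γ ξ‖ ^ 2) := fun ξ => by
    rw [ENNReal.ofReal_mul (Real.exp_pos _).le, ENNReal.ofReal_pow (norm_nonneg _),
      ofReal_norm]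
  have hnn : ∀ ξ, 0 ≤ w ξ * ‖pathAdjoint a γ ξ‖ ^ 2 := fun ξ =>
    mul_nonneg (Real.exp_pos _).le (sq_nonneg _)
  have h2 : ENNReal.ofReal (∫ ξ, w ξ * ‖pathAdjoint a γ ξ‖ ^ 2) =
      ‖∫ p : ℝ × ℝ, ∫ ξ, B ξ p‖ₑ := by
    rw [← integral_integral_swap hBi]
    simp only [← hR]
    rw [integral_complex_ofReal, ← ofReal_norm, Complex.norm_real,
      Real.norm_of_nonneg (integral_nonneg hnn)]
  change ∫⁻ ξ, ENNReal.ofReal (w ξ) * ‖pathAdjoint a γ ξ‖ₑ ^ 2 ≤ _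
  simp only [h1]
  rw [← ofReal_integral_eq_lintegral_ofReal hRi (Eventually.of_forall hnn), h2]
  refine (enorm_integral_le_lintegral_enorm _).trans (le_trans (lintegral_mono fun p => ?_)
    (lintegral_prod_mul_mul_le ha.enorm (measurable_dampedDecay ε).ennreal_ofReal))
  have h3 : ∫ ξ, B ξ p = a p.1 * (starRingEnd ℂ) (a p.2) *
      ∫ ξ, (w ξ : ℂ) * shiftSymbol (γ p.1 - γ p.2) ξ := by
    rw [← integral_const_mul]
    congr 1; ext ξ; simp only [B]; ring
  rw [h3, enorm_mul, enorm_mul]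
  have h4 : ‖(starRingEnd ℂ) (a p.2)‖ₑ = ‖a p.2‖ₑ := by
    rw [← ofReal_norm, RCLike.norm_conj, ofReal_norm]
  rw [h4, ← ofReal_norm (∫ ξ, (w ξ : ℂ) * shiftSymbol (γ p.1 - γ p.2) ξ)]
  gcongr
  have h5 := norm_integral_exp_mul_shiftSymbol_le hε (γ p.1 - γ p.2)
  rwa [Prod.fst_sub, hγt, hγt] at h5

/-- The constant of the `TT*` estimate. -/
noncomputable def ttStarConst : ℝ≥0∞ :=
  2 * ENNReal.ofReal (∫ τ : ℝ, (1 + τ ^ 2) ^ (-(3 / 2) / 2 : ℝ)) *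
    ENNReal.ofReal (∫ ε in Set.Ioi (0 : ℝ), Real.exp (-ε) * ε ^ (-(1 / 2) : ℝ))

theorem ttStarConst_ne_top : ttStarConst ≠ ∞ := by
  unfold ttStarConst
  exact ENNReal.mul_ne_top (ENNReal.mul_ne_top (by norm_num) ENNReal.ofReal_ne_top)
    ENNReal.ofReal_ne_top

theorem enorm_sq_besselSymbol_le (ξ : R3) : ‖besselSymbol ξ‖ₑ ^ 2 ≤
    ∫⁻ ε in Set.Ioi (0 : ℝ), ENNReal.ofReal (Real.exp (-ε)) *
      ENNReal.ofReal (Real.exp (-(ε * ‖(2 * Real.pi) • ξ‖ ^ 2))) := by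
  set ρ := ‖(2 * Real.pi) • ξ‖ with hρ
  have h0 : 0 ≤ ρ := norm_nonneg _
  have h1 : -(1 + ρ ^ 2) < 0 := by nlinarith
  have h2 : ∀ ε : ℝ, ENNReal.ofReal (Real.exp (-ε)) * ENNReal.ofReal (Real.exp (-(ε * ρ ^ 2))) =
      ENNReal.ofReal (Real.exp (-(1 + ρ ^ 2) * ε)) := fun ε => by
    rw [← ENNReal.ofReal_mul (Real.exp_pos _).le, ← Real.exp_add]
    congr 2; ring
  simp only [h2]
  rw [← ofReal_integral_eq_lintegral_ofReal (integrableOn_exp_mul_Ioi h1 0)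
    (Eventually.of_forall fun ε => (Real.exp_pos _).le), integral_exp_mul_Ioi h1,
    ← ofReal_norm, ← ENNReal.ofReal_pow (norm_nonneg _), norm_besselSymbol]
  refine ENNReal.ofReal_le_ofReal ?_
  rw [mul_zero, Real.exp_zero, inv_pow, neg_div_neg_eq, ← one_div]
  refine one_div_le_one_div_of_le (by positivity) ?_
  rw [freqWeight, ← hρ]
  nlinarith

theorem lintegral_bessel_pathAdjoint_le (ha : Measurable a) (hai : Integrable a)
    (hγ : Measurable γ) (hγt : ∀ t, (γ t).1 = t) :
    ∫⁻ ξ, ‖besselSymbol ξ‖ₑ ^ 2 * ‖pathAdjoint a γ ξ‖ₑ ^ 2 ≤ ttStarConst * ∫⁻ t, ‖a t‖ₑ ^ 2 := by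
  have hA := (stronglyMeasurable_pathAdjoint ha hγ).measurable
  have hm : Measurable fun p : R3 × ℝ => ENNReal.ofReal (Real.exp (-p.2)) *
      ENNReal.ofReal (Real.exp (-(p.2 * ‖(2 * Real.pi) • p.1‖ ^ 2))) *
      ‖pathAdjoint a γ p.1‖ₑ ^ 2 := by
    have := (hA.comp (measurable_fst : Measurable (Prod.fst : R3 × ℝ → R3))).enorm
    fun_prop
  calc ∫⁻ ξ, ‖besselSymbol ξ‖ₑ ^ 2 * ‖pathAdjoint a γ ξ‖ₑ ^ 2
      ≤ ∫⁻ ξ, ∫⁻ ε in Set.Ioi (0 : ℝ), ENNReal.ofReal (Real.exp (-ε)) *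
        ENNReal.ofReal (Real.exp (-(ε * ‖(2 * Real.pi) • ξ‖ ^ 2))) * ‖pathAdjoint a γ ξ‖ₑ ^ 2 := by
        refine lintegral_mono fun ξ => ?_
        rw [lintegral_mul_const _ (by fun_prop)]
        exact mul_le_mul_left (enorm_sq_besselSymbol_le ξ) _
    _ = ∫⁻ ε in Set.Ioi (0 : ℝ), ∫⁻ ξ, ENNReal.ofReal (Real.exp (-ε)) *
        ENNReal.ofReal (Real.exp (-(ε * ‖(2 * Real.pi) • ξ‖ ^ 2))) * ‖pathAdjoint a γ ξ‖ₑ ^ 2 :=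
        lintegral_lintegral_swap hm.aemeasurable
    _ ≤ ∫⁻ ε in Set.Ioi (0 : ℝ), (2 * (∫⁻ t, ‖a t‖ₑ ^ 2) *
        ENNReal.ofReal (∫ τ : ℝ, (1 + τ ^ 2) ^ (-(3 / 2) / 2 : ℝ))) *
        ENNReal.ofReal (Real.exp (-ε) * ε ^ (-(1 / 2) : ℝ)) := by
        refine setLIntegral_mono' measurableSet_Ioi fun ε hε => ?_
        simp only [mul_assoc]
        rw [lintegral_const_mul _ (by fun_prop), ENNReal.ofReal_mul (Real.exp_pos _).le]
        have h1 := (lintegral_exp_mul_pathAdjoint_le ha hai hγ hγt hε).trans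
          (mul_le_mul_right (lintegral_dampedDecay_le hε) _)
        calc _ ≤ _ := mul_le_mul_right h1 _
          _ = _ := by ring
    _ = _ := by
        have h2 : IntegrableOn (fun ε : ℝ => Real.exp (-ε) * ε ^ (-(1 / 2) : ℝ)) (Set.Ioi 0) := by
          have := Real.GammaIntegral_convergent (s := 1 / 2) (by norm_num)
          norm_num at this ⊢
          exact this
        rw [lintegral_const_mul _ (by fun_prop), ← ofReal_integral_eq_lintegral_ofReal h2, ttStarConst]
        · ring
        · filter_upwards [ae_restrict_mem measurableSet_Ioi] with ε hε
          exact mul_nonneg (Real.exp_pos _).le (Real.rpow_nonneg (le_of_lt hε) _)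

end TTStar

theorem lintegral_enorm_sq (f : L2) : ∫⁻ ξ, ‖f ξ‖ₑ ^ 2 = ‖f‖ₑ ^ 2 := by
  have h := eLpNorm_nnreal_pow_eq_lintegral (f := f) (μ := volume) (p := 2) two_ne_zero
  rw [Lp.enorm_def]
  simpa using h.symm

/-- Measurable sets of frequencies of finite measure. -/
def Band : Type := {S : Set R3 // MeasurableSet S ∧ volume S ≠ ∞}

/-- The symbol of `bessel`, restricted to a band. -/
noncomputable def bandSymbol (S : Band) : R3 → ℂ := S.1.indicator besselSymbol

theorem norm_bandSymbol_le (S : Band) (ξ : R3) : ‖bandSymbol S ξ‖ ≤ ‖besselSymbol ξ‖ :=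
  norm_indicator_le_norm_self _ _

theorem isBddSymbol_bandSymbol (S : Band) : IsBddSymbol (bandSymbol S) :=
  ⟨continuous_besselSymbol.measurable.indicator S.2.1, 1, fun ξ =>
    (norm_bandSymbol_le S ξ).trans (norm_besselSymbol_le_one ξ)⟩

theorem memLp_bandSymbol (S : Band) : MemLp (bandSymbol S) 2 volume := by
  have : IsFiniteMeasure ((volume : Measure R3).restrict S.1) :=
    ⟨by rw [Measure.restrict_apply_univ]; exact S.2.2.lt_top⟩
  exact (memLp_indicator_iff_restrict S.2.1).2
    (MemLp.of_bound continuous_besselSymbol.aestronglyMeasurable 1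
      (Eventually.of_forall norm_besselSymbol_le_one))

/-- The kernel of the evaluation functional on a band. -/
noncomputable def bandKernel (S : Band) : L2 := (memLp_bandSymbol S).toLp

/-- The value at a point of space-time of the band limited evolution. -/
noncomputable def bandEval (S : Band) (Y : L2) (g : ShiftGroup) : ℂ :=
  inner ℂ (bandKernel S) (shiftOp g Y)

/-- The band limited part of `bessel Y`. -/
noncomputable def bandProj (S : Band) (Y : L2) : L2 := 𝓕⁻ (mulOp _ (isBddSymbol_bandSymbol S) Y)

theorem conj_bandSymbol (S : Band) (ξ : R3) :
    (starRingEnd ℂ) (bandSymbol S ξ) = bandSymbol S ξ := by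
  unfold bandSymbol besselSymbol
  by_cases h : ξ ∈ S.1 <;> simp [h]

theorem conj_bandKernel_mul_ae_eq (S : Band) (Y : L2) :
    (fun ξ => (starRingEnd ℂ) (bandKernel S ξ) * Y ξ) =ᵐ[volume]
      mulOp _ (isBddSymbol_bandSymbol S) Y := by
  filter_upwards [(memLp_bandSymbol S).coeFn_toLp,
    coeFn_mulOp _ (isBddSymbol_bandSymbol S) Y] with ξ h1 h2
  rw [bandKernel, h1, h2, conj_bandSymbol]

theorem integrable_mulOp_bandSymbol (S : Band) (Y : L2) :
    Integrable (mulOp _ (isBddSymbol_bandSymbol S) Y) :=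
  (integrable_conj_mul (bandKernel S) Y).congr (conj_bandKernel_mul_ae_eq S Y)

theorem bandEval_eq_integral (S : Band) (Y : L2) (g : ShiftGroup) :
    bandEval S Y g = ∫ ξ, shiftSymbol g ξ * mulOp _ (isBddSymbol_bandSymbol S) Y ξ := by
  rw [bandEval, inner_shiftOp]
  refine integral_congr_ae ?_
  filter_upwards [conj_bandKernel_mul_ae_eq S Y] with ξ h
  rw [h]

theorem continuous_bandEval (S : Band) (Y : L2) : Continuous (bandEval S Y) :=
  continuous_const.inner (continuous_shiftOp Y)

theorem norm_bandEval_le (S : Band) (Y : L2) (g : ShiftGroup) :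
    ‖bandEval S Y g‖ ≤ ‖bandKernel S‖ * ‖Y‖ := by
  refine (norm_inner_le_norm _ _).trans_eq ?_
  rw [LinearIsometryEquiv.norm_map]

theorem coeFn_bandProj_shiftOp (S : Band) (Y : L2) (t : ℝ) :
    bandProj S (shiftOp (t, 0) Y) =ᵐ[volume] fun x => bandEval S Y (t, -x) := by
  filter_upwards [coeFn_fourierInv (integrable_mulOp_bandSymbol S (shiftOp (t, 0) Y))] with x h
  rw [bandProj, h, ← bandEval_eq_integral, bandEval, bandEval, ← shiftOp_add, Prod.mk_add_mk,
    zero_add, add_zero]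

section Path

variable {S : Band} {Y : L2} {γ : ℝ → ShiftGroup}

theorem integral_mul_bandEval {a : ℝ → ℂ} (hai : Integrable a)
    (hγ : Measurable γ) :
    ∫ t, a t * bandEval S Y (γ t) =
      ∫ ξ, mulOp _ (isBddSymbol_bandSymbol S) Y ξ * pathAdjoint a γ ξ := by
  set Z := mulOp _ (isBddSymbol_bandSymbol S) Y with hZdef
  have hZ : Integrable Z := integrable_mulOp_bandSymbol S Y
  have hi : Integrable (Function.uncurry fun (t : ℝ) (ξ : R3) =>
      a t * (shiftSymbol (γ t) ξ * Z ξ)) (volume.prod volume) := by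
    have hm : Measurable fun p : ℝ × R3 => shiftSymbol (γ p.1) p.2 :=
      continuous_shiftSymbol.measurable.comp ((hγ.comp measurable_fst).prodMk measurable_snd)
    have := (hai.mul_prod hZ).bdd_mul hm.aestronglyMeasurable
      (Eventually.of_forall fun p => (norm_shiftSymbol (γ p.1) p.2).le)
    refine this.congr (Eventually.of_forall fun p => ?_)
    simp only [Function.uncurry]
    ring
  calc ∫ t, a t * bandEval S Y (γ t) = ∫ t, ∫ ξ, a t * (shiftSymbol (γ t) ξ * Z ξ) := by
        refine integral_congr_ae (Eventually.of_forall fun t => ?_)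
        simp only [bandEval_eq_integral]
        rw [integral_const_mul]
    _ = ∫ ξ, ∫ t, a t * (shiftSymbol (γ t) ξ * Z ξ) := integral_integral_swap hi
    _ = _ := by
        refine integral_congr_ae (Eventually.of_forall fun ξ => ?_)
        simp only [pathAdjoint]
        rw [← integral_const_mul]
        congr 1; ext t; ring

theorem setLIntegral_bandEval_path_le (hγ : Measurable γ) (hγt : ∀ t, (γ t).1 = t) {s : Set ℝ}
    (hs : MeasurableSet s) (hsf : volume s ≠ ∞) :
    ∫⁻ t in s, ‖bandEval S Y (γ t)‖ₑ ^ 2 ≤ ttStarConst * ‖Y‖ₑ ^ 2 := by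
  let v : ℝ → ℂ := fun t => bandEval S Y (γ t)
  have hv : Measurable v := (continuous_bandEval S Y).measurable.comp hγ
  let a : ℝ → ℂ := s.indicator fun t => (starRingEnd ℂ) (v t)
  have ha : Measurable a := (Complex.continuous_conj.measurable.comp hv).indicator hs
  have hai : Integrable a := by
    rw [integrable_indicator_iff hs]
    have : IsFiniteMeasure ((volume : Measure ℝ).restrict s) :=
      ⟨by rw [Measure.restrict_apply_univ]; exact hsf.lt_top⟩
    refine Integrable.of_bound (C := ‖bandKernel S‖ * ‖Y‖)
      (Complex.continuous_conj.measurable.comp hv).aestronglyMeasurable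
      (Eventually.of_forall fun t => ?_)
    rw [RCLike.norm_conj]
    exact norm_bandEval_le S Y _
  have hea : ∀ t, ‖a t‖ₑ ^ 2 = s.indicator (fun t => ‖v t‖ₑ ^ 2) t := fun t => by
    by_cases h : t ∈ s
    · simp only [a, Set.indicator_of_mem h]
      rw [← ofReal_norm, RCLike.norm_conj, ofReal_norm]
    · simp [a, h]
  have hJ : ∫⁻ t in s, ‖v t‖ₑ ^ 2 = ∫⁻ t, ‖a t‖ₑ ^ 2 := by
    rw [← lintegral_indicator hs]
    exact lintegral_congr fun t => (hea t).symm
  have hsq : ∀ t, a t * v t = ((‖a t‖ ^ 2 : ℝ) : ℂ) := fun t => by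
    by_cases h : t ∈ s
    · simp only [a, Set.indicator_of_mem h]
      rw [RCLike.norm_conj, mul_comm, Complex.mul_conj, Complex.normSq_eq_norm_sq]
    · simp [a, h]
  have hfin : ∫⁻ t, ‖a t‖ₑ ^ 2 ≠ ∞ := by
    rw [← hJ]
    refine ((setLIntegral_mono (g := fun _ => ENNReal.ofReal (‖bandKernel S‖ * ‖Y‖) ^ 2)
      measurable_const fun t _ => ?_).trans_lt ?_).ne
    · rw [← ofReal_norm]
      gcongr
      exact norm_bandEval_le S Y _
    · rw [setLIntegral_const]
      exact ENNReal.mul_lt_top (ENNReal.pow_lt_top ENNReal.ofReal_lt_top) hsf.lt_top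
  have hsqi : Integrable fun t => ‖a t‖ ^ 2 := by
    refine ⟨(ha.norm.pow_const 2).aestronglyMeasurable, ?_⟩
    refine lt_of_eq_of_lt (lintegral_congr fun t => ?_) hfin.lt_top
    rw [enorm_pow, enorm_norm]
  have h1 : ∫⁻ t, ‖a t‖ₑ ^ 2 = ‖∫ t, a t * v t‖ₑ := by
    simp only [hsq]
    rw [integral_complex_ofReal, ← ofReal_norm, Complex.norm_real,
      Real.norm_of_nonneg (integral_nonneg fun t => sq_nonneg _),
      ofReal_integral_eq_lintegral_ofReal hsqi (Eventually.of_forall fun t => sq_nonneg _)]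
    refine lintegral_congr fun t => ?_
    rw [ENNReal.ofReal_pow (norm_nonneg _), ofReal_norm]
  have hA := (stronglyMeasurable_pathAdjoint ha hγ).measurable
  have h2 : ∫⁻ t, ‖a t‖ₑ ^ 2 ≤ ∫⁻ ξ, ‖Y ξ‖ₑ * (‖besselSymbol ξ‖ₑ * ‖pathAdjoint a γ ξ‖ₑ) := by
    rw [h1, integral_mul_bandEval hai hγ]
    refine (enorm_integral_le_lintegral_enorm _).trans (lintegral_mono_ae ?_)
    filter_upwards [coeFn_mulOp _ (isBddSymbol_bandSymbol S) Y] with ξ h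
    rw [enorm_mul, h, enorm_mul, mul_comm ‖bandSymbol S ξ‖ₑ, mul_assoc]
    gcongr
    exact enorm_le_iff_norm_le.2 (norm_bandSymbol_le S ξ)
  have h3 : (∫⁻ ξ, ‖Y ξ‖ₑ * (‖besselSymbol ξ‖ₑ * ‖pathAdjoint a γ ξ‖ₑ)) ^ 2 ≤
      ‖Y‖ₑ ^ 2 * (ttStarConst * ∫⁻ t, ‖a t‖ₑ ^ 2) := by
    have h4 := ENNReal.lintegral_mul_le_Lp_mul_Lq (volume : Measure R3) Real.HolderConjugate.two_two
      (Lp.aestronglyMeasurable Y).enorm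
      ((continuous_besselSymbol.measurable.enorm.mul hA.enorm).aemeasurable)
    simp only [Pi.mul_apply, ENNReal.rpow_two, mul_pow] at h4
    refine (pow_le_pow_left' h4 2).trans ?_
    rw [mul_pow, ← ENNReal.rpow_natCast, ← ENNReal.rpow_natCast, ← ENNReal.rpow_mul,
      ← ENNReal.rpow_mul]
    norm_num
    rw [lintegral_enorm_sq]
    gcongr
    exact lintegral_bessel_pathAdjoint_le ha hai hγ hγt
  change ∫⁻ t in s, ‖v t‖ₑ ^ 2 ≤ _
  rw [hJ]
  set J := ∫⁻ t, ‖a t‖ₑ ^ 2 with hJdef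
  have h5 : J * J ≤ J * (ttStarConst * ‖Y‖ₑ ^ 2) := by
    calc J * J = J ^ 2 := (sq J).symm
      _ ≤ _ := pow_le_pow_left' h2 2
      _ ≤ _ := h3
      _ = _ := by ring
  rcases eq_or_ne J 0 with h0 | h0
  · rw [h0]; exact zero_le
  · exact (ENNReal.mul_le_mul_iff_right h0 hfin).1 h5

theorem lintegral_bandEval_path_le (hγ : Measurable γ) (hγt : ∀ t, (γ t).1 = t) :
    ∫⁻ t, ‖bandEval S Y (γ t)‖ₑ ^ 2 ≤ ttStarConst * ‖Y‖ₑ ^ 2 := by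
  have hU : (⋃ n : ℕ, Set.Icc (-(n : ℝ)) n) = Set.univ := by
    refine Set.eq_univ_of_forall fun t => ?_
    obtain ⟨n, hn⟩ := exists_nat_ge |t|
    exact Set.mem_iUnion.2 ⟨n, abs_le.1 hn⟩
  rw [← setLIntegral_univ, ← hU, setLIntegral_iUnion_of_directed]
  · exact iSup_le fun n => setLIntegral_bandEval_path_le hγ hγt measurableSet_Icc (by simp)
  · refine Monotone.directed_le fun m n hmn => ?_
    have : (m : ℝ) ≤ n := by exact_mod_cast hmn
    exact Set.Icc_subset_Icc (by linarith) this

end Path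

theorem exists_measurable_path (S : Band) (Y : L2) (d : ℕ → R3) (N : ℕ) :
    ∃ γ : ℝ → ShiftGroup, Measurable γ ∧ (∀ t, (γ t).1 = t) ∧
      ∀ t, ∀ k ≤ N, ‖bandEval S Y (t, d k)‖ₑ ≤ ‖bandEval S Y (γ t)‖ₑ := by
  induction N with
  | zero =>
    refine ⟨fun t => (t, d 0), by fun_prop, fun t => rfl, fun t k hk => ?_⟩
    rw [Nat.le_zero.1 hk]
  | succ N ih =>
    obtain ⟨γ, hγ, hγt, h⟩ := ih
    have hm1 : Measurable fun t => ‖bandEval S Y (t, d (N + 1))‖ₑ :=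
      ((continuous_bandEval S Y).measurable.comp (by fun_prop)).enorm
    have hm2 : Measurable fun t => ‖bandEval S Y (γ t)‖ₑ :=
      ((continuous_bandEval S Y).measurable.comp hγ).enorm
    classical
    refine ⟨fun t => if ‖bandEval S Y (t, d (N + 1))‖ₑ ≤ ‖bandEval S Y (γ t)‖ₑ then γ t
      else (t, d (N + 1)), ?_, fun t => ?_, fun t k hk => ?_⟩
    · exact Measurable.ite (measurableSet_le hm1 hm2) hγ (by fun_prop)
    · dsimp only
      split_ifs
      · exact hγt t
      · rfl
    · dsimp only
      split_ifs with hc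
      · rcases Nat.le_succ_iff.1 hk with hk | rfl
        · exact h t k hk
        · exact hc
      · rcases Nat.le_succ_iff.1 hk with hk | rfl
        · exact (h t k hk).trans (not_le.1 hc).le
        · exact le_rfl

theorem lintegral_iSup_bandEval_le (S : Band) (Y : L2) (d : ℕ → R3) :
    ∫⁻ t, ⨆ k, ‖bandEval S Y (t, d k)‖ₑ ^ 2 ≤ ttStarConst * ‖Y‖ₑ ^ 2 := by
  have hm : ∀ k, Measurable fun t => ‖bandEval S Y (t, d k)‖ₑ ^ 2 := fun k =>
    (((continuous_bandEval S Y).measurable.comp (by fun_prop)).enorm).pow_const 2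
  have h1 : ∀ t, ⨆ k, ‖bandEval S Y (t, d k)‖ₑ ^ 2 =
      ⨆ N : ℕ, ⨆ k, ⨆ (_ : k ≤ N), ‖bandEval S Y (t, d k)‖ₑ ^ 2 := fun t =>
    biSup_le_eq_iSup.symm
  simp only [h1]
  rw [lintegral_iSup]
  · refine iSup_le fun N => ?_
    obtain ⟨γ, hγ, hγt, h⟩ := exists_measurable_path S Y d N
    refine (lintegral_mono fun t => ?_).trans
      (lintegral_bandEval_path_le (S := S) (Y := Y) hγ hγt)
    exact iSup₂_le fun k hk => pow_le_pow_left' (h t k hk) 2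
  · exact fun N => Measurable.iSup fun k => Measurable.iSup fun _ => hm k
  · intro M N hMN t
    exact iSup₂_mono' fun k hk => ⟨k, hk.trans hMN, le_rfl⟩

/-- Norms are lower semicontinuous for `L²` convergence. -/
theorem eLpNorm_le_of_frequently {f : ℕ → L2} {g : L2} (hf : Tendsto f atTop (𝓝 g)) {p c : ℝ≥0∞}
    (h : ∃ᶠ n in atTop, eLpNorm (f n) p volume ≤ c) : eLpNorm g p volume ≤ c := by
  obtain ⟨θ, hθ, hc⟩ := extraction_of_frequently_atTop h
  obtain ⟨ns, hns, hae⟩ :=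
    (tendstoInMeasure_of_tendsto_Lp (hf.comp hθ.tendsto_atTop)).exists_seq_tendsto_ae
  refine (Lp.eLpNorm_lim_le_liminf_eLpNorm (f := fun i => (f (θ (ns i)) : R3 → ℂ))
    (fun i => Lp.aestronglyMeasurable _) g hae).trans ?_
  exact liminf_le_of_frequently_le' (Eventually.of_forall fun i => hc (ns i)).frequently

/-- The ball of radius `2 ^ n`. -/
noncomputable def ballBand (n : ℕ) : Band :=
  ⟨Metric.closedBall 0 (2 ^ n), measurableSet_closedBall, measure_closedBall_lt_top.ne⟩

theorem tendsto_bandProj_ballBand (Y : L2) :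
    Tendsto (fun n => bandProj (ballBand n) Y) atTop (𝓝 (bessel Y)) := by
  refine ((Lp.fourierTransformₗᵢ R3 ℂ).symm.continuous.tendsto _).comp
    (g := fun Z : L2 => (Lp.fourierTransformₗᵢ R3 ℂ).symm Z) ?_
  rw [Lp.tendsto_Lp_iff_tendsto_eLpNorm']
  have hlim := tendsto_lintegral_of_dominated_convergence'
    (F := fun (n : ℕ) ξ => ‖(bandSymbol (ballBand n) ξ - besselSymbol ξ) * Y ξ‖ₑ ^ 2)
    (f := fun _ => 0) (μ := volume) (fun ξ => ‖Y ξ‖ₑ ^ 2) ?_ ?_ ?_ ?_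
  · rw [lintegral_zero] at hlim
    have hlim' := (ENNReal.continuous_rpow_const (y := (1 / 2 : ℝ))).tendsto 0 |>.comp hlim
    rw [ENNReal.zero_rpow_of_pos (by norm_num)] at hlim'
    refine hlim'.congr fun n => ?_
    rw [eLpNorm_eq_lintegral_rpow_enorm_toReal two_ne_zero ENNReal.ofNat_ne_top]
    simp only [ENNReal.toReal_ofNat, ENNReal.rpow_two, Function.comp_apply]
    congr 1
    refine lintegral_congr_ae ?_
    filter_upwards [coeFn_mulOp _ (isBddSymbol_bandSymbol (ballBand n)) Y,
      coeFn_mulOp _ isBddSymbol_besselSymbol Y] with ξ h1 h2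
    change _ = ‖mulOp _ (isBddSymbol_bandSymbol (ballBand n)) Y ξ -
      mulOp _ isBddSymbol_besselSymbol Y ξ‖ₑ ^ 2
    rw [h1, h2, sub_mul]
  · intro n
    have h1 : Measurable fun ξ => bandSymbol (ballBand n) ξ - besselSymbol ξ :=
      (isBddSymbol_bandSymbol _).1.sub continuous_besselSymbol.measurable
    exact (h1.aestronglyMeasurable.mul (Lp.aestronglyMeasurable Y)).enorm.pow_const 2
  · intro n
    refine Eventually.of_forall fun ξ => ?_
    dsimp only
    gcongr
    rw [enorm_mul]
    refine mul_le_of_le_one_left' ?_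
    rw [← ofReal_norm, ENNReal.ofReal_le_one]
    by_cases h : ξ ∈ (ballBand n).1
    · simp [bandSymbol, h]
    · simpa [bandSymbol, h] using norm_besselSymbol_le_one ξ
  · rw [lintegral_enorm_sq]
    exact ENNReal.pow_ne_top enorm_ne_top
  · refine Eventually.of_forall fun ξ => ?_
    refine tendsto_const_nhds.congr' ?_
    obtain ⟨N, hN⟩ := pow_unbounded_of_one_lt ‖ξ‖ (one_lt_two (α := ℝ))
    filter_upwards [eventually_ge_atTop N] with n hn
    have h1 : ξ ∈ Metric.closedBall (0 : R3) (2 ^ n) := by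
      rw [mem_closedBall_zero_iff]
      exact hN.le.trans (pow_le_pow_right₀ one_le_two hn)
    have h2 : bandSymbol (ballBand n) ξ = besselSymbol ξ := Set.indicator_of_mem h1 _
    simp [h2]

theorem lintegral_eLpNorm_top_bessel_le (Y : L2) :
    ∫⁻ t : ℝ, eLpNorm (bessel (shiftOp (t, 0) Y)) ∞ volume ^ 2 ≤ ttStarConst * ‖Y‖ₑ ^ 2 := by
  obtain ⟨d, hd⟩ := TopologicalSpace.exists_dense_seq R3
  let Φ : ℕ → ℝ → ℝ≥0∞ := fun n t => ⨆ k, ‖bandEval (ballBand n) Y (t, d k)‖ₑ ^ 2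
  have hΦ : ∀ n, Measurable (Φ n) := fun n => Measurable.iSup fun k =>
    (((continuous_bandEval _ Y).measurable.comp (by fun_prop)).enorm).pow_const 2
  have h1 : ∀ n t, eLpNorm (bandProj (ballBand n) (shiftOp (t, 0) Y)) ∞ volume ≤
      Φ n t ^ (1 / 2 : ℝ) := by
    intro n t
    have h2 : ∀ y, ‖bandEval (ballBand n) Y (t, y)‖ₑ ^ 2 ≤ Φ n t := by
      have hcl : IsClosed {y | ‖bandEval (ballBand n) Y (t, y)‖ₑ ^ 2 ≤ Φ n t} := by
        refine isClosed_le ?_ continuous_const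
        have h3 : Continuous fun y : R3 => bandEval (ballBand n) Y (t, y) :=
          (continuous_bandEval _ Y).comp (by fun_prop)
        exact (ENNReal.continuous_pow 2).comp h3.enorm
      have hr : Set.range d ⊆ {y | ‖bandEval (ballBand n) Y (t, y)‖ₑ ^ 2 ≤ Φ n t} := by
        rintro _ ⟨k, rfl⟩
        exact le_iSup (fun k => ‖bandEval (ballBand n) Y (t, d k)‖ₑ ^ 2) k
      intro y
      have := hcl.closure_subset_iff.2 hr (hd y)
      exact this
    rw [eLpNorm_exponent_top]
    refine essSup_le_of_ae_le _ ?_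
    filter_upwards [coeFn_bandProj_shiftOp (ballBand n) Y t] with x h4
    rw [h4]
    have := ENNReal.rpow_le_rpow (h2 (-x)) (show (0 : ℝ) ≤ 1 / 2 by norm_num)
    rwa [← ENNReal.rpow_natCast, ← ENNReal.rpow_mul, Nat.cast_ofNat, mul_one_div_cancel two_ne_zero,
      ENNReal.rpow_one] at this
  have h5 : ∀ t, eLpNorm (bessel (shiftOp (t, 0) Y)) ∞ volume ^ 2 ≤
      liminf (fun n => Φ n t) atTop := by
    intro t
    refine le_of_forall_gt_imp_ge_of_dense fun c hc => ?_
    have h6 := eLpNorm_le_of_frequently (tendsto_bandProj_ballBand (shiftOp (t, 0) Y))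
      (p := ∞) (c := c ^ (1 / 2 : ℝ)) ((frequently_lt_of_liminf_lt (by isBoundedDefault) hc).mono
        fun n hn => (h1 n t).trans (ENNReal.rpow_le_rpow hn.le (by norm_num)))
    have h7 := pow_le_pow_left' h6 2
    rwa [← ENNReal.rpow_natCast (c ^ _), ← ENNReal.rpow_mul, Nat.cast_ofNat,
      one_div_mul_cancel two_ne_zero, ENNReal.rpow_one] at h7
  calc _ ≤ ∫⁻ t, liminf (fun n => Φ n t) atTop := lintegral_mono h5
    _ ≤ liminf (fun n => ∫⁻ t, Φ n t) atTop := lintegral_liminf_le hΦ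
    _ ≤ _ := liminf_le_of_frequently_le'
        (Eventually.of_forall fun n => lintegral_iSup_bandEval_le _ Y d).frequently

theorem eLpNorm_le_eLpNorm_rpow_mul_top {f : R3 → ℂ} (hf : AEStronglyMeasurable f volume)
    {p r : ℝ≥0∞} (hp : p ≠ 0) (hpr : p ≤ r) (hr : r ≠ ∞) :
    eLpNorm f r volume ≤ eLpNorm f p volume ^ (p.toReal / r.toReal) *
      eLpNorm f ∞ volume ^ (1 - p.toReal / r.toReal) := by
  have hp' : p ≠ ∞ := (hpr.trans_lt hr.lt_top).ne
  have ha : 0 < p.toReal := ENNReal.toReal_pos hp hp'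
  have hab : p.toReal ≤ r.toReal := ENNReal.toReal_mono hr hpr
  have hb : 0 < r.toReal := ha.trans_le hab
  have hr0 : r ≠ 0 := (ENNReal.toReal_pos_iff.1 hb).1.ne'
  set a := p.toReal with ha_def
  set b := r.toReal with hb_def
  set M := eLpNorm f ∞ volume with hM
  have h1 : ∫⁻ x, ‖f x‖ₑ ^ b ≤ (∫⁻ x, ‖f x‖ₑ ^ a) * M ^ (b - a) := by
    rw [← lintegral_mul_const'' _ (hf.enorm.pow_const a)]
    refine lintegral_mono_ae ?_
    have h2 : ∀ᵐ x, ‖f x‖ₑ ≤ M := by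
      rw [hM, eLpNorm_exponent_top]; exact ae_le_eLpNormEssSup
    filter_upwards [h2] with x hx
    have h3 : ‖f x‖ₑ ^ b = ‖f x‖ₑ ^ a * ‖f x‖ₑ ^ (b - a) := by
      rw [← ENNReal.rpow_add_of_nonneg _ _ ha.le (sub_nonneg.2 hab), add_sub_cancel]
    rw [h3]
    exact mul_le_mul_right (ENNReal.rpow_le_rpow hx (sub_nonneg.2 hab)) _
  rw [eLpNorm_eq_lintegral_rpow_enorm_toReal hr0 hr,
    eLpNorm_eq_lintegral_rpow_enorm_toReal hp hp', ← ENNReal.rpow_mul, ← ha_def, ← hb_def]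
  refine (ENNReal.rpow_le_rpow h1 (by positivity)).trans_eq ?_
  rw [ENNReal.mul_rpow_of_nonneg _ _ (by positivity), ← ENNReal.rpow_mul]
  congr 2 <;> field_simp

theorem eLpNorm_three_pow_le {f : R3 → ℂ} (hf : AEStronglyMeasurable f volume) :
    eLpNorm f 3 volume ^ 3 ≤ eLpNorm f 2 volume ^ 2 * eLpNorm f ∞ volume := by
  have h := pow_le_pow_left' (eLpNorm_le_eLpNorm_rpow_mul_top hf (p := 2) (r := 3) two_ne_zero
    (by norm_num) (by norm_num)) 3
  refine h.trans_eq ?_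
  rw [mul_pow, ← ENNReal.rpow_natCast, ← ENNReal.rpow_natCast, ← ENNReal.rpow_mul,
    ← ENNReal.rpow_mul]
  norm_num

section Strichartz

/-- Interpolation of all the admissible norms between `L^∞_t L^3_x` and `L^2_t L^∞_x`. -/
theorem strichartzNorm_le {q₀ r₀ : ℝ≥0∞} (hr₀ : r₀ < 6) {u : ℝ → L2} {A B : ℝ≥0∞} (hA : A ≠ ∞)
    (h3 : ∀ t, eLpNorm (u t) 3 volume ≤ A)
    (htop : ∫⁻ t, eLpNorm (u t) ∞ volume ^ 2 ≤ B ^ 2) :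
    strichartzNorm q₀ r₀ u ≤ (A + A ^ (1 / 2 : ℝ)) * (1 + B) := by
  refine iSup_le fun q => iSup_le fun r => iSup_le fun ⟨hadm, hr3, hrr, _⟩ => ?_
  have hr6 : r < 6 := hrr.trans_lt hr₀
  have hrtop : r ≠ ∞ := (hr6.trans (by norm_num)).ne
  have hr0 : r ≠ 0 := fun h => by simp [h] at hr3
  have hq0 : q ≠ 0 := fun h => by
    rw [HalfAdmissible, h, ENNReal.div_zero two_ne_zero, top_add] at hadm
    exact ENNReal.top_ne_one hadm
  rcases eq_or_ne q ∞ with rfl | hqtop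
  · have hr : r = 3 := by
      rw [HalfAdmissible, ENNReal.div_top, zero_add,
        ENNReal.div_eq_one_iff hr0 hrtop] at hadm
      exact hadm.symm
    subst hr
    have h1 : mixedNorm ∞ 3 u ≤ A := by
      rw [mixedNorm, eLpNorm_exponent_top]
      exact essSup_le_of_ae_le _ (Eventually.of_forall fun t => h3 t)
    calc mixedNorm ∞ 3 u ≤ A := h1
      _ ≤ A + A ^ (1 / 2 : ℝ) := le_self_add
      _ ≤ _ := le_mul_of_one_le_right' le_self_add
  · set κ := q.toReal with hκ
    set ρ := r.toReal with hρ
    have hκ0 : 0 < κ := ENNReal.toReal_pos hq0 hqtop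
    have hρ3 : 3 ≤ ρ := by
      have := ENNReal.toReal_mono hrtop hr3
      simpa using this
    have hρ6 : ρ < 6 := by
      have := (ENNReal.toReal_lt_toReal hrtop (by norm_num)).2 hr6
      simpa using this
    have hρ0 : 0 < ρ := by linarith
    have hrel : 2 / κ + 3 / ρ = 1 := by
      have := congrArg ENNReal.toReal hadm
      rw [ENNReal.toReal_add (ENNReal.div_ne_top (by norm_num) hq0)
        (ENNReal.div_ne_top (by norm_num) hr0), ENNReal.toReal_div, ENNReal.toReal_div] at this
      simpa using this
    have hθ : 1 - 3 / ρ = 2 / κ := by linarith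
    have h1 : ∀ t, eLpNorm (u t) r volume ≤ A ^ (3 / ρ) * eLpNorm (u t) ∞ volume ^ (2 / κ) := by
      intro t
      have := eLpNorm_le_eLpNorm_rpow_mul_top (Lp.aestronglyMeasurable (u t)) (p := 3) (by norm_num)
        hr3 hrtop
      rw [← hρ, ENNReal.toReal_ofNat, hθ] at this
      exact this.trans (mul_le_mul_left (ENNReal.rpow_le_rpow (h3 t) (by positivity)) _)
    have h2 : mixedNorm q r u ≤ A ^ (3 / ρ) * B ^ (2 / κ) := by
      rw [mixedNorm, eLpNorm_eq_lintegral_rpow_enorm_toReal hq0 hqtop, ← hκ]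
      have h4 : ∫⁻ t, ‖eLpNorm (u t) r volume‖ₑ ^ κ ≤ (A ^ (3 / ρ)) ^ κ * B ^ 2 := by
        calc ∫⁻ t, ‖eLpNorm (u t) r volume‖ₑ ^ κ
            ≤ ∫⁻ t, (A ^ (3 / ρ)) ^ κ * eLpNorm (u t) ∞ volume ^ 2 := by
              refine lintegral_mono fun t => ?_
              rw [enorm_eq_self]
              refine (ENNReal.rpow_le_rpow (h1 t) hκ0.le).trans_eq ?_
              rw [ENNReal.mul_rpow_of_nonneg _ _ hκ0.le, ← ENNReal.rpow_mul _ (2 / κ),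
                div_mul_cancel₀ _ hκ0.ne', ENNReal.rpow_two]
          _ = (A ^ (3 / ρ)) ^ κ * ∫⁻ t, eLpNorm (u t) ∞ volume ^ 2 :=
              lintegral_const_mul' _ _ (ENNReal.rpow_ne_top_of_nonneg hκ0.le
                (ENNReal.rpow_ne_top_of_nonneg (by positivity) hA))
          _ ≤ _ := mul_le_mul_right htop _
      refine (ENNReal.rpow_le_rpow h4 (by positivity)).trans_eq ?_
      rw [ENNReal.mul_rpow_of_nonneg _ _ (by positivity), ← ENNReal.rpow_mul (A ^ (3 / ρ)),
        mul_one_div_cancel hκ0.ne', ENNReal.rpow_one, ← ENNReal.rpow_two, ← ENNReal.rpow_mul,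
        mul_one_div]
    have h5 : A ^ (3 / ρ) ≤ A + A ^ (1 / 2 : ℝ) := by
      rcases le_total 1 A with h | h
      · calc A ^ (3 / ρ) ≤ A ^ (1 : ℝ) :=
              ENNReal.rpow_le_rpow_of_exponent_le h ((div_le_one hρ0).2 hρ3)
          _ = A := ENNReal.rpow_one A
          _ ≤ _ := le_self_add
      · refine (ENNReal.rpow_le_rpow_of_exponent_ge h ?_).trans le_add_self
        rw [div_le_div_iff₀ (by norm_num) hρ0]; linarith
    have h6 : B ^ (2 / κ) ≤ 1 + B := by
      rcases le_total 1 B with h | h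
      · calc B ^ (2 / κ) ≤ B ^ (1 : ℝ) := by
              refine ENNReal.rpow_le_rpow_of_exponent_le h ?_
              have : 0 ≤ 3 / ρ := by positivity
              linarith
          _ = B := ENNReal.rpow_one B
          _ ≤ _ := le_add_self
      · exact (ENNReal.rpow_le_one h (by positivity)).trans le_self_add
    exact h2.trans (mul_le_mul' h5 h6)

end Strichartz

/-- The dyadic annulus of inner radius `2 ^ k`. -/
noncomputable def annulusBand (k : ℕ) : Band :=
  ⟨Metric.closedBall 0 (2 ^ (k + 1)) \ Metric.closedBall 0 (2 ^ k),
    measurableSet_closedBall.diff measurableSet_closedBall,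
    (measure_mono Set.sdiff_subset).trans_lt measure_closedBall_lt_top |>.ne⟩

theorem bandProj_ballBand_succ (k : ℕ) (Y : L2) :
    bandProj (ballBand (k + 1)) Y = bandProj (ballBand k) Y + bandProj (annulusBand k) Y := by
  have h : mulOp _ (isBddSymbol_bandSymbol (ballBand (k + 1))) Y =
      mulOp _ (isBddSymbol_bandSymbol (ballBand k)) Y +
        mulOp _ (isBddSymbol_bandSymbol (annulusBand k)) Y := by
    refine Lp.ext ?_
    filter_upwards [coeFn_mulOp _ (isBddSymbol_bandSymbol (ballBand (k + 1))) Y,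
      coeFn_mulOp _ (isBddSymbol_bandSymbol (ballBand k)) Y,
      coeFn_mulOp _ (isBddSymbol_bandSymbol (annulusBand k)) Y,
      Lp.coeFn_add (mulOp _ (isBddSymbol_bandSymbol (ballBand k)) Y)
        (mulOp _ (isBddSymbol_bandSymbol (annulusBand k)) Y)] with ξ h1 h2 h3 h4
    rw [h4, Pi.add_apply, h1, h2, h3, ← add_mul]
    congr 1
    have hsub : (Metric.closedBall (0 : R3) (2 ^ k)) ⊆ Metric.closedBall 0 (2 ^ (k + 1)) :=
      Metric.closedBall_subset_closedBall (pow_le_pow_right₀ one_le_two (Nat.le_succ k))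
    simp only [bandSymbol, ballBand, annulusBand]
    by_cases ha : ξ ∈ Metric.closedBall (0 : R3) (2 ^ k)
    · rw [Set.indicator_of_mem (hsub ha), Set.indicator_of_mem ha,
        Set.indicator_of_notMem (fun h => h.2 ha), add_zero]
    · rw [Set.indicator_of_notMem ha, zero_add]
      by_cases hb : ξ ∈ Metric.closedBall (0 : R3) (2 ^ (k + 1))
      · have hmem : ξ ∈ Metric.closedBall (0 : R3) (2 ^ (k + 1)) \ Metric.closedBall 0 (2 ^ k) :=
          ⟨hb, ha⟩
        rw [Set.indicator_of_mem hb, Set.indicator_of_mem hmem]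
      · rw [Set.indicator_of_notMem hb, Set.indicator_of_notMem fun h => hb h.1]
  rw [bandProj, h]
  exact (Lp.fourierTransformₗᵢ R3 ℂ).symm.map_add _ _

theorem eLpNorm_two_bandProj_le (S : Band) {C : ℝ} (hC : ∀ ξ, ‖bandSymbol S ξ‖ ≤ C) (Y : L2) :
    eLpNorm (bandProj S Y) 2 volume ≤ ENNReal.ofReal (C * ‖Y‖) := by
  rw [eLpNorm_coe_eq]
  refine ENNReal.ofReal_le_ofReal ?_
  have h : ‖bandProj S Y‖ = ‖mulOp _ (isBddSymbol_bandSymbol S) Y‖ :=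
    (Lp.fourierTransformₗᵢ R3 ℂ).symm.norm_map _
  rw [h]
  exact norm_mulOp_le _ hC Y

theorem eLpNorm_top_bandProj_le (S : Band) {Y : L2} {δ : ℝ} (hδ : ∀ g, ‖bandEval S Y g‖ ≤ δ)
    (t : ℝ) : eLpNorm (bandProj S (shiftOp (t, 0) Y)) ∞ volume ≤ ENNReal.ofReal δ := by
  rw [eLpNorm_exponent_top]
  refine essSup_le_of_ae_le _ ?_
  filter_upwards [coeFn_bandProj_shiftOp S Y t] with x h
  rw [h, ← ofReal_norm]
  exact ENNReal.ofReal_le_ofReal (hδ _)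

theorem eLpNorm_three_bandProj_pow_le (S : Band) {Y : L2} {C δ : ℝ}
    (hC : ∀ ξ, ‖bandSymbol S ξ‖ ≤ C) (hδ : ∀ g, ‖bandEval S Y g‖ ≤ δ) (t : ℝ) :
    eLpNorm (bandProj S (shiftOp (t, 0) Y)) 3 volume ^ 3 ≤
      ENNReal.ofReal ((C * ‖Y‖) ^ 2 * δ) := by
  have hC0 : 0 ≤ C := (norm_nonneg _).trans (hC 0)
  refine (eLpNorm_three_pow_le (Lp.aestronglyMeasurable _)).trans ?_
  rw [ENNReal.ofReal_mul (by positivity), ENNReal.ofReal_pow (by positivity)]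
  have h1 := eLpNorm_two_bandProj_le S hC (shiftOp (t, 0) Y)
  rw [LinearIsometryEquiv.norm_map] at h1
  exact mul_le_mul' (pow_le_pow_left' h1 2) (eLpNorm_top_bandProj_le S hδ t)

theorem norm_bandSymbol_annulusBand_le (k : ℕ) (ξ : R3) :
    ‖bandSymbol (annulusBand k) ξ‖ ≤ (1 / 2) ^ k := by
  by_cases h : ξ ∈ (annulusBand k).1
  · rw [bandSymbol, Set.indicator_of_mem h, norm_besselSymbol, one_div, inv_pow]
    have h1 : (2 : ℝ) ^ k < ‖ξ‖ := by
      have := h.2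
      rwa [mem_closedBall_zero_iff, not_le] at this
    refine inv_anti₀ (by positivity) ?_
    rw [freqWeight, norm_smul, Real.norm_of_nonneg (by positivity)]
    nlinarith [Real.pi_gt_three, norm_nonneg ξ]
  · rw [bandSymbol, Set.indicator_of_notMem h, norm_zero]; positivity

theorem norm_sq_bandKernel_annulusBand_le (k : ℕ) :
    ‖bandKernel (annulusBand k)‖ ^ 2 ≤
      ((1 / 2) ^ k) ^ 2 * ((2 ^ (k + 1)) ^ 3 * (volume (Metric.ball (0 : R3) 1)).toReal) := by
  have hfin : volume (Metric.ball (0 : R3) 1) ≠ ∞ := measure_ball_lt_top.ne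
  have h1 : ‖bandKernel (annulusBand k)‖ₑ ^ 2 ≤ ENNReal.ofReal ((1 / 2) ^ k) ^ 2 *
      volume (Metric.closedBall (0 : R3) (2 ^ (k + 1))) := by
    rw [← lintegral_enorm_sq, ← setLIntegral_const, ← lintegral_indicator measurableSet_closedBall]
    refine lintegral_mono_ae ?_
    filter_upwards [(memLp_bandSymbol (annulusBand k)).coeFn_toLp] with ξ h
    rw [bandKernel, h]
    by_cases hξ : ξ ∈ Metric.closedBall (0 : R3) (2 ^ (k + 1))
    · rw [Set.indicator_of_mem hξ, ← ofReal_norm]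
      gcongr
      exact norm_bandSymbol_annulusBand_le k ξ
    · have : bandSymbol (annulusBand k) ξ = 0 := Set.indicator_of_notMem (fun h => hξ h.1) _
      simp [this]
  rw [Measure.addHaar_closedBall _ _ (by positivity), finrank_euclideanSpace, Fintype.card_fin,
    ← ENNReal.ofReal_toReal hfin, ← ENNReal.ofReal_mul (by positivity),
    ← ENNReal.ofReal_pow (by positivity), ← ENNReal.ofReal_mul (by positivity), ← ofReal_norm,
    ← ENNReal.ofReal_pow (norm_nonneg _), ENNReal.ofReal_le_ofReal_iff (by positivity)] at h1
  exact h1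

/-- The constant of the dyadic `L³` bounds. -/
noncomputable def dyadicConst : ℝ := 8 * (volume (Metric.ball (0 : R3) 1)).toReal + 1

theorem one_le_dyadicConst : 1 ≤ dyadicConst := by
  unfold dyadicConst
  linarith [ENNReal.toReal_nonneg (a := volume (Metric.ball (0 : R3) 1))]

theorem eLpNorm_three_bandProj_annulusBand_le (k : ℕ) (Y : L2) (t : ℝ) :
    eLpNorm (bandProj (annulusBand k) (shiftOp (t, 0) Y)) 3 volume ≤
      ENNReal.ofReal (dyadicConst * (3 / 4) ^ k * ‖Y‖) := by
  have hD := one_le_dyadicConst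
  have h1 := eLpNorm_three_bandProj_pow_le (annulusBand k) (norm_bandSymbol_annulusBand_le k)
    (norm_bandEval_le (annulusBand k) Y) t
  rw [← ENNReal.pow_le_pow_left_iff three_ne_zero, ← ENNReal.ofReal_pow (by positivity)]
  refine h1.trans (ENNReal.ofReal_le_ofReal ?_)
  set κ := ‖bandKernel (annulusBand k)‖
  have h2 : ((1 / 2 : ℝ) ^ k) ^ 2 * κ ≤ (dyadicConst * (3 / 4) ^ k) ^ 3 := by
    refine le_of_sq_le_sq ?_ (by positivity)
    have h3 := norm_sq_bandKernel_annulusBand_le k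
    calc (((1 / 2 : ℝ) ^ k) ^ 2 * κ) ^ 2 = (((1 / 2 : ℝ) ^ k) ^ 2) ^ 2 * κ ^ 2 := by ring
      _ ≤ (((1 / 2 : ℝ) ^ k) ^ 2) ^ 2 * (((1 / 2) ^ k) ^ 2 *
          ((2 ^ (k + 1)) ^ 3 * (volume (Metric.ball (0 : R3) 1)).toReal)) := by gcongr
      _ = (8 * (volume (Metric.ball (0 : R3) 1)).toReal) * ((1 / 2) ^ 6 * 2 ^ 3) ^ k := by
          have : ((1 / 2 : ℝ) ^ 6 * 2 ^ 3) ^ k = ((1 / 2) ^ k) ^ 6 * (2 ^ k) ^ 3 := by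
            rw [mul_pow, pow_right_comm, pow_right_comm 2 3 k]
          rw [this]; ring
      _ ≤ dyadicConst ^ 6 * ((3 / 4) ^ 6) ^ k := by
          gcongr
          · refine le_trans ?_ (le_self_pow₀ hD (by norm_num))
            unfold dyadicConst; linarith
          · norm_num
      _ = ((dyadicConst * (3 / 4) ^ k) ^ 3) ^ 2 := by
          rw [← pow_mul]; ring
  have hy := norm_nonneg Y
  calc ((1 / 2 : ℝ) ^ k * ‖Y‖) ^ 2 * (κ * ‖Y‖) = (((1 / 2 : ℝ) ^ k) ^ 2 * κ) * ‖Y‖ ^ 3 := by ring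
    _ ≤ (dyadicConst * (3 / 4) ^ k) ^ 3 * ‖Y‖ ^ 3 := by gcongr
    _ = _ := by ring

theorem eLpNorm_three_bandProj_ballBand_add_le (N j : ℕ) (Y : L2) (t : ℝ) :
    eLpNorm (bandProj (ballBand (N + j)) (shiftOp (t, 0) Y)) 3 volume ≤
      eLpNorm (bandProj (ballBand N) (shiftOp (t, 0) Y)) 3 volume +
        ENNReal.ofReal (4 * dyadicConst * (3 / 4) ^ N * (1 - (3 / 4) ^ j) * ‖Y‖) := by
  have hD := one_le_dyadicConst
  induction j with
  | zero => simp
  | succ j ih =>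
    have hle : (0 : ℝ) ≤ 1 - (3 / 4) ^ j :=
      sub_nonneg.2 (pow_le_one₀ (by norm_num) (by norm_num))
    rw [← add_assoc, bandProj_ballBand_succ]
    have h1 : eLpNorm (bandProj (ballBand (N + j)) (shiftOp (t, 0) Y) +
        bandProj (annulusBand (N + j)) (shiftOp (t, 0) Y) : L2) 3 volume ≤ _ :=
      (eLpNorm_congr_ae (Lp.coeFn_add _ _)).trans_le
        (eLpNorm_add_le (Lp.aestronglyMeasurable _) (Lp.aestronglyMeasurable _) (by norm_num))
    refine h1.trans ((add_le_add ih (eLpNorm_three_bandProj_annulusBand_le _ Y t)).trans_eq ?_)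
    rw [add_assoc, ← ENNReal.ofReal_add (by positivity) (by positivity)]
    congr 2
    rw [pow_add, pow_succ]
    ring

theorem eLpNorm_three_bessel_le {C δ : ℝ} {Y : L2} (hY : ‖Y‖ ≤ C) {N : ℕ}
    (hδ : ∀ g, ‖bandEval (ballBand N) Y g‖ ≤ δ) (t : ℝ) :
    eLpNorm (bessel (shiftOp (t, 0) Y)) 3 volume ≤
      ENNReal.ofReal (C ^ 2 * δ) ^ (1 / 3 : ℝ) +
        ENNReal.ofReal (4 * dyadicConst * (3 / 4) ^ N * C) := by
  have hD := one_le_dyadicConst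
  have hδ0 : 0 ≤ δ := (norm_nonneg _).trans (hδ 0)
  have h1 : eLpNorm (bandProj (ballBand N) (shiftOp (t, 0) Y)) 3 volume ≤
      ENNReal.ofReal (C ^ 2 * δ) ^ (1 / 3 : ℝ) := by
    have h2 := eLpNorm_three_bandProj_pow_le (ballBand N) (C := 1)
      (fun ξ => (norm_bandSymbol_le _ ξ).trans (norm_besselSymbol_le_one ξ)) hδ t
    have h3 := ENNReal.rpow_le_rpow h2 (show (0 : ℝ) ≤ 1 / 3 by norm_num)
    rw [← ENNReal.rpow_natCast, ← ENNReal.rpow_mul, Nat.cast_ofNat,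
      mul_one_div_cancel three_ne_zero, ENNReal.rpow_one, one_mul] at h3
    refine h3.trans (ENNReal.rpow_le_rpow (ENNReal.ofReal_le_ofReal ?_) (by norm_num))
    gcongr
  refine eLpNorm_le_of_frequently (tendsto_bandProj_ballBand (shiftOp (t, 0) Y))
    (Eventually.frequently ?_)
  filter_upwards [eventually_ge_atTop N] with n hn
  obtain ⟨j, rfl⟩ := Nat.exists_eq_add_of_le hn
  refine (eLpNorm_three_bandProj_ballBand_add_le N j Y t).trans (add_le_add h1 ?_)
  refine ENNReal.ofReal_le_ofReal ?_
  have h4 : (1 : ℝ) - (3 / 4) ^ j ≤ 1 := sub_le_self _ (by positivity)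
  have h5 : (0 : ℝ) ≤ 1 - (3 / 4) ^ j := sub_nonneg.2 (pow_le_one₀ (by norm_num) (by norm_num))
  calc 4 * dyadicConst * (3 / 4) ^ N * (1 - (3 / 4) ^ j) * ‖Y‖
      ≤ 4 * dyadicConst * (3 / 4) ^ N * 1 * C := by gcongr
    _ = _ := by ring

/-- The bound for the Strichartz norm in terms of a bound `δ` for the low frequency part. -/
noncomputable def strichartzBound (C δ : ℝ) (N : ℕ) : ℝ≥0∞ :=
  (ENNReal.ofReal (C ^ 2 * δ) ^ (1 / 3 : ℝ) + ENNReal.ofReal (4 * dyadicConst * (3 / 4) ^ N * C) +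
    (ENNReal.ofReal (C ^ 2 * δ) ^ (1 / 3 : ℝ) +
      ENNReal.ofReal (4 * dyadicConst * (3 / 4) ^ N * C)) ^ (1 / 2 : ℝ)) *
    (1 + (ttStarConst * ENNReal.ofReal C ^ 2) ^ (1 / 2 : ℝ))

theorem strichartz_factor_ne_top (C : ℝ) :
    1 + (ttStarConst * ENNReal.ofReal C ^ 2) ^ (1 / 2 : ℝ) ≠ ∞ :=
  ENNReal.add_ne_top.2 ⟨ENNReal.one_ne_top, ENNReal.rpow_ne_top_of_nonneg (by norm_num)
    (ENNReal.mul_ne_top ttStarConst_ne_top (ENNReal.pow_ne_top ENNReal.ofReal_ne_top))⟩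

theorem strichartzBound_ne_top (C δ : ℝ) (N : ℕ) : strichartzBound C δ N ≠ ∞ := by
  have h : ENNReal.ofReal (C ^ 2 * δ) ^ (1 / 3 : ℝ) +
      ENNReal.ofReal (4 * dyadicConst * (3 / 4) ^ N * C) ≠ ∞ :=
    ENNReal.add_ne_top.2
      ⟨ENNReal.rpow_ne_top_of_nonneg (by norm_num) ENNReal.ofReal_ne_top, ENNReal.ofReal_ne_top⟩
  exact ENNReal.mul_ne_top
    (ENNReal.add_ne_top.2 ⟨h, ENNReal.rpow_ne_top_of_nonneg (by norm_num) h⟩)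
    (strichartz_factor_ne_top C)

theorem strichartzNorm_bessel_le {q₀ r₀ : ℝ≥0∞} (hr₀ : r₀ < 6) {C δ : ℝ} {Y : L2} (hY : ‖Y‖ ≤ C)
    {N : ℕ} (hδ : ∀ g, ‖bandEval (ballBand N) Y g‖ ≤ δ) :
    strichartzNorm q₀ r₀ (fun τ => schrodinger τ (bessel Y)) ≤ strichartzBound C δ N := by
  simp only [schrodinger_bessel]
  refine strichartzNorm_le hr₀ ?_ (eLpNorm_three_bessel_le hY hδ) ?_
  · exact ENNReal.add_ne_top.2
      ⟨ENNReal.rpow_ne_top_of_nonneg (by norm_num) ENNReal.ofReal_ne_top, ENNReal.ofReal_ne_top⟩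
  · refine (lintegral_eLpNorm_top_bessel_le Y).trans ?_
    rw [← ENNReal.rpow_natCast (_ ^ (1 / 2 : ℝ)), ← ENNReal.rpow_mul, Nat.cast_ofNat,
      one_div_mul_cancel two_ne_zero, ENNReal.rpow_one, ← ofReal_norm]
    gcongr

theorem tendsto_strichartzBound (C : ℝ) :
    Tendsto (fun n : ℕ => strichartzBound C (1 / (n + 1)) n) atTop (𝓝 0) := by
  have h1 : Tendsto (fun n : ℕ => ENNReal.ofReal (C ^ 2 * (1 / (n + 1))) ^ (1 / 3 : ℝ)) atTop
      (𝓝 0) := by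
    have := ENNReal.tendsto_ofReal ((tendsto_one_div_add_atTop_nhds_zero_nat (𝕜 := ℝ)).const_mul
      (C ^ 2))
    have h := (ENNReal.continuous_rpow_const (y := (1 / 3 : ℝ))).tendsto _ |>.comp this
    simpa [Function.comp_def] using h
  have h2 : Tendsto (fun n : ℕ => ENNReal.ofReal (4 * dyadicConst * (3 / 4) ^ n * C)) atTop
      (𝓝 0) := by
    have := ENNReal.tendsto_ofReal (((tendsto_pow_atTop_nhds_zero_of_lt_one
      (show (0 : ℝ) ≤ 3 / 4 by norm_num) (by norm_num)).const_mul (4 * dyadicConst)).mul_const C)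
    simpa using this
  have h3 := h1.add h2
  rw [add_zero] at h3
  have h4 := (ENNReal.continuous_rpow_const (y := (1 / 2 : ℝ))).tendsto _ |>.comp h3
  rw [ENNReal.zero_rpow_of_pos (by norm_num)] at h4
  have h5 := ENNReal.Tendsto.mul_const (h3.add h4) (Or.inr (strichartz_factor_ne_top C))
  rw [add_zero, zero_mul] at h5
  exact h5

/-- If all weak limits of translates of `w` are small, then so are its low frequencies. -/
theorem eventually_norm_bandEval_le {𝒰 : Ultrafilter ℕ} {w : ℕ → L2Pair} {D η δ : ℝ}
    (hD : ∀ n, ‖w n‖ ≤ D)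
    (hw : ∀ (h : ℕ → ShiftGroup) (χ : L2Pair),
      WeakTendsto (fun n => pairShiftOp (-h n) (w n)) 𝒰 χ → ‖χ‖ ≤ η)
    (S : Band) (hδ : ‖bandKernel S‖ * η < δ) (i : Fin 2) :
    ∀ᶠ n in 𝒰, ∀ g, ‖bandEval S (w n i) g‖ ≤ δ := by
  by_contra hc
  rw [← Ultrafilter.eventually_not] at hc
  have h1 : ∀ n, ∃ g, (¬ ∀ g, ‖bandEval S (w n i) g‖ ≤ δ) → δ < ‖bandEval S (w n i) g‖ := by
    intro n
    by_cases h : ∀ g, ‖bandEval S (w n i) g‖ ≤ δ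
    · exact ⟨0, fun h' => absurd h h'⟩
    · push Not at h
      obtain ⟨g, hg⟩ := h
      exact ⟨g, fun _ => hg⟩
  choose g hg using h1
  obtain ⟨χ, hχ⟩ := exists_weakTendsto 𝒰 (f := fun n => pairShiftOp (g n) (w n)) (C := D)
    fun n => by rw [LinearIsometryEquiv.norm_map]; exact hD n
  have h2 : ‖χ‖ ≤ η := hw (fun n => -g n) χ (by simpa only [neg_neg] using hχ)
  have h3 : Tendsto (fun n => ‖bandEval S (w n i) (g n)‖) 𝒰 (𝓝 ‖inner ℂ (bandKernel S) (χ i)‖) :=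
    ((hχ.apply i) (bandKernel S)).norm
  have h4 : δ ≤ ‖inner ℂ (bandKernel S) (χ i)‖ := by
    refine ge_of_tendsto h3 ?_
    filter_upwards [hc] with n hn using (hg n hn).le
  have h5 : ‖inner ℂ (bandKernel S) (χ i)‖ ≤ ‖bandKernel S‖ * η :=
    (norm_inner_le_norm _ _).trans
      (mul_le_mul_of_nonneg_left ((PiLp.norm_apply_le χ i).trans h2) (norm_nonneg _))
  linarith

theorem norm_toLp_pair_le (f g : L2) : ‖(WithLp.toLp 2 ![f, g] : L2Pair)‖ ≤ ‖f‖ + ‖g‖ := by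
  refine le_of_sq_le_sq ?_ (by positivity)
  rw [PiLp.norm_sq_eq_of_L2, Fin.sum_univ_two]
  simp only [Matrix.cons_val_zero, Matrix.cons_val_one]
  nlinarith [norm_nonneg f, norm_nonneg g]

section Conclusion

variable {ψ : ℕ → L2} {g : ℕ → ℕ → ShiftGroup} {W : ℕ → ℕ → L2}

theorem bessel_eq_sum_add (hW : ∀ M n, W M n = shiftOp (g M n) (ψ M) + W (M + 1) n) (M n : ℕ) :
    bessel (W 0 n) = (∑ j ∈ Finset.range M, spaceShift (g j n).2
      (schrodinger (- -(g j n).1) (bessel (ψ j)))) + bessel (W M n) := by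
  induction M with
  | zero => simp
  | succ M ih =>
    rw [ih, hW M n, Finset.sum_range_succ, spaceShift_schrodinger_bessel, neg_neg, Prod.mk.eta,
      map_add, add_assoc]

theorem tendsto_homSobolevNorm_expansion
    (hW : ∀ M n, W M n = shiftOp (g M n) (ψ M) + W (M + 1) n)
    (hw : ∀ M, WeakTendsto (fun n => shiftOp (-g M n) (W (M + 1) n)) atTop 0)
    {s : ℝ} (hs : s ∈ Set.Icc (0 : ℝ) 1) (M : ℕ) :
    Tendsto (fun n => (homSobolevNorm s (bessel (W 0 n))).toReal ^ 2 -
      ((∑ j ∈ Finset.range M, (homSobolevNorm s (bessel (ψ j))).toReal ^ 2) +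
        (homSobolevNorm s (bessel (W M n))).toReal ^ 2)) atTop (𝓝 0) := by
  induction M with
  | zero => simp
  | succ M ih =>
    have h1 := (isMixingRep_shiftOp.tendsto_norm_sq_sub (U' := shiftOp)
      (mulOp _ (isBddSymbol_rieszBesselSymbol hs)) (mulOp_shiftOp _) (hW M) (hw M)).const_mul
      (dilationConst.toReal ^ 2)
    rw [mul_zero] at h1
    have h2 := ih.add h1
    rw [add_zero] at h2
    refine h2.congr fun n => ?_
    rw [Finset.sum_range_succ]
    simp only [toReal_homSobolevNorm_bessel hs, mul_pow]
    ring

end Conclusion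

end ProfileDecomposition

open ProfileDecomposition in
theorem theorem4p1 (q₀ r₀ : ℝ≥0∞) (hq₀ : 4 < q₀) (hr₀ : r₀ < 6)
    (φ φ' : ℕ → L2) (hφ : BoundedInH1 φ) (hφ' : BoundedInH1 φ') :
    ∃ σ : ℕ → ℕ, StrictMono σ ∧
    ∃ (ψ ψ' : ℕ → L2) (t : ℕ → ℕ → ℝ) (x : ℕ → ℕ → R3) (W W' : ℕ → ℕ → L2),
      (∀ j, MemH1 (ψ j) ∧ MemH1 (ψ' j)) ∧
      (∀ M n, MemH1 (W M n) ∧ MemH1 (W' M n)) ∧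
      (∀ M n,
        φ (σ n) =
          (∑ j ∈ Finset.range M, spaceShift (x j n) (schrodinger (-t j n) (ψ j))) + W M n ∧
        φ' (σ n) =
          (∑ j ∈ Finset.range M, spaceShift (x j n) (schrodinger (-t j n) (ψ' j))) + W' M n) ∧
      (∀ j k, j ≠ k →
        Tendsto (fun n => |t j n - t k n| + ‖x j n - x k n‖) atTop atTop) ∧
      (∃ L : ℕ → ℝ≥0,
        (∀ M, Tendsto
          (fun n => strichartzNorm q₀ r₀ (fun τ => schrodinger τ (W M n)) +
            strichartzNorm q₀ r₀ (fun τ => schrodinger τ (W' M n)))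
          atTop (𝓝 (L M : ℝ≥0∞))) ∧
        Tendsto L atTop (𝓝 0)) ∧
      (∀ s ∈ Set.Icc (0 : ℝ) 1, ∀ M,
        Tendsto
          (fun n => (homSobolevNorm s (φ (σ n))).toReal ^ 2 -
            ((∑ j ∈ Finset.range M, (homSobolevNorm s (ψ j)).toReal ^ 2) +
              (homSobolevNorm s (W M n)).toReal ^ 2))
          atTop (𝓝 0) ∧
        Tendsto
          (fun n => (homSobolevNorm s (φ' (σ n))).toReal ^ 2 -
            ((∑ j ∈ Finset.range M, (homSobolevNorm s (ψ' j)).toReal ^ 2) +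
              (homSobolevNorm s (W' M n)).toReal ^ 2))
          atTop (𝓝 0)) := by
  obtain ⟨Y, C₁, hY, hC₁⟩ := hφ.exists_eq_bessel
  obtain ⟨Y', C₂, hY', hC₂⟩ := hφ'.exists_eq_bessel
  have h𝒰 : (hyperfilter ℕ : Filter ℕ) ≤ atTop := Nat.hyperfilter_le_atTop
  obtain ⟨ψ, g, W, hW0, hW, horth, hweak, hψ, hbd, hbdD, hmax⟩ :=
    isMixingRep_pairShiftOp.exists_profileDecomposition h𝒰 (C := C₁ + C₂)
      (φ := fun n => WithLp.toLp 2 ![Y n, Y' n])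
      fun n => (norm_toLp_pair_le _ _).trans (add_le_add (hC₁ n) (hC₂ n))
  set 𝒰 := hyperfilter ℕ
  set C := C₁ + C₂ + 1 with hC
  let T : ℕ → ℕ → ℝ≥0∞ := fun M n =>
    strichartzNorm q₀ r₀ (fun τ => schrodinger τ (bessel (W M n 0))) +
      strichartzNorm q₀ r₀ (fun τ => schrodinger τ (bessel (W M n 1)))
  have hT : ∀ M, ∀ (N : ℕ) (δ : ℝ), ‖bandKernel (ballBand N)‖ * (2 * ‖ψ M‖) < δ →
      ∀ᶠ n in 𝒰, T M n ≤ strichartzBound C δ N + strichartzBound C δ N := by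
    intro M N δ hδ
    obtain ⟨D, hD⟩ := hbdD M
    filter_upwards [hbd M, eventually_norm_bandEval_le hD (hmax M) (ballBand N) hδ 0,
      eventually_norm_bandEval_le hD (hmax M) (ballBand N) hδ 1] with n h1 h2 h3
    exact add_le_add (strichartzNorm_bessel_le hr₀ ((PiLp.norm_apply_le _ 0).trans h1) h2)
      (strichartzNorm_bessel_le hr₀ ((PiLp.norm_apply_le _ 1).trans h1) h3)
  have hlim : ∀ M, ∃ ℓ : ℝ≥0∞, Tendsto (T M) 𝒰 (𝓝 ℓ) := fun M =>
    ⟨_, (𝒰.map (T M)).le_nhds_lim⟩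
  choose ℓ hℓ using hlim
  have hℓtop : ∀ M, ℓ M ≠ ∞ := fun M => by
    refine ((le_of_tendsto (hℓ M) (hT M 0 (‖bandKernel (ballBand 0)‖ * (2 * ‖ψ M‖) + 1)
      (by linarith))).trans_lt ?_).ne
    exact ENNReal.add_lt_top.2
      ⟨(strichartzBound_ne_top _ _ _).lt_top, (strichartzBound_ne_top _ _ _).lt_top⟩
  have hℓ0 : Tendsto ℓ atTop (𝓝 0) := by
    rw [ENNReal.tendsto_nhds_zero]
    intro ε hε
    obtain ⟨N, hN⟩ := (ENNReal.tendsto_nhds_zero.1 (tendsto_strichartzBound C) (ε / 2)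
      (ENNReal.half_pos hε.ne')).exists
    have h1 : Tendsto (fun M => ‖bandKernel (ballBand N)‖ * (2 * ‖ψ M‖)) atTop (𝓝 0) := by
      simpa using (hψ.norm.const_mul 2).const_mul ‖bandKernel (ballBand N)‖
    filter_upwards [h1.eventually (gt_mem_nhds (show (0 : ℝ) < 1 / (N + 1) by positivity))]
      with M hM
    refine (le_of_tendsto (hℓ M) (hT M N _ hM)).trans ?_
    calc _ ≤ ε / 2 + ε / 2 := add_le_add hN hN
      _ = ε := ENNReal.add_halves ε
  have : Fact ((2 : ℝ≥0∞) ≠ ∞) := ⟨ENNReal.ofNat_ne_top⟩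
  let e : ℕ → L2 := TopologicalSpace.denseSeq L2
  let 𝓛₁ : Filter ℕ := ⨅ p : {p : ℕ × ℕ // p.1 ≠ p.2},
    comap (fun n => ‖g p.1.1 n - g p.1.2 n‖) atTop
  let 𝓛₂ : Filter ℕ := ⨅ p : Fin 2 × ℕ × ℕ,
    comap (fun n => inner ℂ (e p.2.2) (shiftOp (-g p.2.1 n) (W (p.2.1 + 1) n p.1))) (𝓝 0)
  let 𝓛₃ : Filter ℕ := ⨅ M, comap (T M) (𝓝 (ℓ M))
  have h𝓛₁ : (𝒰 : Filter ℕ) ≤ 𝓛₁ := le_iInf fun p =>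
    ((tendsto_norm_cocompact_atTop).comp (horth _ _ p.2)).le_comap
  have h𝓛₂ : (𝒰 : Filter ℕ) ≤ 𝓛₂ := le_iInf fun p => Tendsto.le_comap (by
    have := ((hweak p.2.1).apply p.1) (e p.2.2)
    rwa [PiLp.zero_apply, inner_zero_right] at this)
  have h𝓛₃ : (𝒰 : Filter ℕ) ≤ 𝓛₃ := le_iInf fun M => (hℓ M).le_comap
  have hne : (atTop ⊓ 𝓛₁ ⊓ 𝓛₂ ⊓ 𝓛₃).NeBot :=
    𝒰.neBot.mono (le_inf (le_inf (le_inf h𝒰 h𝓛₁) h𝓛₂) h𝓛₃)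
  obtain ⟨σ, hσ, hσ𝓛⟩ := exists_strictMono_tendsto (atTop ⊓ 𝓛₁ ⊓ 𝓛₂ ⊓ 𝓛₃)
    (inf_le_left.trans (inf_le_left.trans inf_le_left))
  have hσ₁ : ∀ j k, j ≠ k → Tendsto (fun n => ‖g j (σ n) - g k (σ n)‖) atTop atTop :=
    fun j k hjk => tendsto_comap_iff (g := fun n => ‖g j n - g k n‖).1
      (hσ𝓛.mono_right (inf_le_left.trans (inf_le_left.trans
        (inf_le_right.trans (iInf_le _ (⟨(j, k), hjk⟩ : {p : ℕ × ℕ // p.1 ≠ p.2}))))))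
  have hσ₂ : ∀ i M, WeakTendsto (fun n => shiftOp (-g M (σ n)) (W (M + 1) (σ n) i)) atTop 0 := by
    intro i M
    obtain ⟨D, hD⟩ := hbdD (M + 1)
    refine weakTendsto_zero_of_dense (C := D) (fun n => ?_) (TopologicalSpace.denseRange_denseSeq L2) ?_
    · rw [LinearIsometryEquiv.norm_map]
      exact (PiLp.norm_apply_le _ i).trans (hD _)
    · rintro _ ⟨k, rfl⟩
      exact tendsto_comap_iff (g := fun n =>
        inner ℂ (e k) (shiftOp (-g M n) (W (M + 1) n i))).1 (hσ𝓛.mono_right (inf_le_left.trans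
        (inf_le_right.trans (iInf_le _ (i, M, k)))))
  have hσ₃ : ∀ M, Tendsto (fun n => T M (σ n)) atTop (𝓝 (ℓ M)) := fun M =>
    tendsto_comap_iff.1 (hσ𝓛.mono_right (inf_le_right.trans (iInf_le _ M)))
  have hWi : ∀ i M n, W M (σ n) i = shiftOp (g M (σ n)) (ψ M i) + W (M + 1) (σ n) i :=
    fun i M n => by rw [hW M (σ n)]; rfl
  have hφσ : ∀ n, φ (σ n) = bessel (W 0 (σ n) 0) := fun n => by rw [hW0, hY]; rfl
  have hφσ' : ∀ n, φ' (σ n) = bessel (W 0 (σ n) 1) := fun n => by rw [hW0, hY']; rfl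
  refine ⟨σ, hσ, fun j => bessel (ψ j 0), fun j => bessel (ψ j 1), fun j n => -(g j (σ n)).1,
    fun j n => (g j (σ n)).2, fun M n => bessel (W M (σ n) 0), fun M n => bessel (W M (σ n) 1),
    fun j => ⟨memH1_bessel _, memH1_bessel _⟩, fun M n => ⟨memH1_bessel _, memH1_bessel _⟩,
    fun M n => ⟨?_, ?_⟩, fun j k hjk => ?_, ⟨fun M => (ℓ M).toNNReal, fun M => ?_, ?_⟩,
    fun s hs M => ⟨?_, ?_⟩⟩
  · rw [hφσ]
    exact bessel_eq_sum_add (g := fun j n => g j (σ n)) (hWi 0) M n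
  · rw [hφσ']
    exact bessel_eq_sum_add (g := fun j n => g j (σ n)) (hWi 1) M n
  · refine tendsto_atTop_mono (fun n => ?_) (hσ₁ j k hjk)
    rw [Prod.norm_def, Prod.fst_sub, Prod.snd_sub]
    refine max_le ?_ ?_
    · rw [neg_sub_neg, abs_sub_comm, Real.norm_eq_abs]
      exact le_add_of_nonneg_right (norm_nonneg _)
    · exact le_add_of_nonneg_left (abs_nonneg _)
  · rw [ENNReal.coe_toNNReal (hℓtop M)]
    exact hσ₃ M
  · have := (ENNReal.tendsto_toNNReal ENNReal.zero_ne_top).comp hℓ0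
    simpa using! this
  · simp only [hφσ]
    exact tendsto_homSobolevNorm_expansion (g := fun j n => g j (σ n)) (hWi 0) (hσ₂ 0) hs M
  · simp only [hφσ']
    exact tendsto_homSobolevNorm_expansion (g := fun j n => g j (σ n)) (hWi 1) (hσ₂ 1) hs M
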